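/- **Setting.** Let $(S,\mu)$ be a measurable space with a $\sigma$-finite reference measure (for instance a subset of $\mathbb R^s$ with Lebesgue measure, or a countable set with counting measure), and let $\Theta$ be a measurable parameter space (for instance $\Theta\subseteq\mathbb R^d$) with a prior probability measure $\pi$. For each $\theta\in\Theta$ let $p_\theta(y\mid x)$ be a Markov transition density with respect to $\mu$, jointly measurable in $(\theta,y,x)$, with invariant probability density $q_\theta$. Let $q^{(0)}$ be a known initial probability density, which does not depend on $\theta$, and put $$p^{(n)}_\theta(x_0,\dots,x_n)=q^{(0)}(x_0)\prod_{i=0}^{n-1}p_\theta(x_{i+1}\mid x_i),\qquad P^{(n)}_\theta=p_\theta^{(n)}\,d\mu^{\otimes(n+1)},\qquad r_n(\theta,\theta_0)=\log\frac{p^{(n)}_{\theta_0}}{p^{(n)}_\theta}.$$ $\mathcal K$ is the Kullback--Leibler divergence. Expectations and variances are taken under $P^{(n)}_{\theta_0}$, for a fixed true parameter $\theta_0\in\Theta$. Let $\mathcal F$ be a set of probability measures on $\Theta$ and let $\rho_n\in\mathcal F$ for $n\ge1$. **Generalized Lipschitz assumption** (with exponent $\delta>0$). There are measurable functions $M^{(1)}_k(y,x)\ge0$,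 $M^{(2)}_k(x)\ge0$ and functions $f^{(1)}_k,f^{(2)}_k:\Theta\times\Theta\to\mathbb R$, $1\le k\le m$, with $f^{(t)}_k(\cdot,\theta_0)$ measurable, such that for all $\theta_1,\theta_2\in\Theta$ and all $x,y\in S$ $$|\log p_{\theta_1}(y\mid x)-\log p_{\theta_2}(y\mid x)|\le\sum_{k=1}^m M^{(1)}_k(y,x)\,|f_k^{(1)}(\theta_2,\theta_1)|,\qquad |\log q_{\theta_1}(x)-\log q_{\theta_2}(x)|\le\sum_{k=1}^m M^{(2)}_k(x)\,|f_k^{(2)}(\theta_2,\theta_1)|$$ (where $\log 0=-\infty$ and $|\log 0-\log 0|=0$), and * there are constants $C^{(t)}_k$ with $\int|f^{(t)}_k(\theta,\theta_0)|^{2+\delta}\rho_n(d\theta)<C^{(t)}_k/n$ for $t\in\{1,2\}$, all $k$ and all $n\ge1$; * there is a constant $B$ with $\iint M^{(1)}_k(y,x)^{2+\delta}\,p_\theta(y\mid x)\,q_\theta(x)\,\mu(dy)\,\mu(dx)<B$ for all $k$ and all $\theta\in\Theta$. **$V$-geometric ergodicity.** For measurable $V:S\to[1,\infty)$, the chain with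 transition density $p_{\theta_0}$ and invariant law $Q_{\theta_0}=q_{\theta_0}\,d\mu$ is $V$-geometrically ergodic if it is positive Harris, $\int V\,dQ_{\theta_0}<\infty$, and there are $r>1$, $R<\infty$ such that, for all $x\in S$ and $n\ge0$, $$\big\|P_{\theta_0}(X_n\in\cdot\mid X_0=x)-Q_{\theta_0}\big\|_V\le R\,V(x)\,r^{-n},\qquad \|v\|_V:=\sup_{|g|<V}\Big|\int g\,dv\Big|.$$ **Theorem.** Suppose that the chain with transition density $p_{\theta_0}$ is aperiodic and $V$-geometrically ergodic for some measurable $V:S\to[1,\infty)$, that the generalized Lipschitz assumption holds with exponent $\delta>0$, and that, for the same $\delta$, $$\int M^{(1)}_k(y,x)^{2+\delta}\,p_{\theta_0}(y\mid x)\,\mu(dy)<V(x)\qquad\text{for all }k\text{ and }x.$$ Suppose further that $\mathcal K(\rho_n,\pi)\le C\sqrt n$ for all $n\ge1$ and some constant $C>0$, and that $\int V q^{(0)}\,d\mu<\infty$. Then there are $\epsilon_n>0$ with $$\epsilon_n=O\!\left(\max\Big(\frac1{\sqrt n},\frac{n^{\delta/2}}n\Big)\right)$$ such that the conditions of the PAC-Bayes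 bound hold for every $n\ge1$ with these $\rho_n\in\mathcal F$: 1. $\int\mathcal K(P^{(n)}_{\theta_0},P^{(n)}_\theta)\,\rho_n(d\theta)=\int \mathrm E[r_n(\theta,\theta_0)]\,\rho_n(d\theta)\le n\epsilon_n$ (in particular, all these expectations exist); 2. $\int\mathrm{Var}\big(r_n(\theta,\theta_0)\big)\,\rho_n(d\theta)\le n\epsilon_n$; 3. $\mathcal K(\rho_n,\pi)\le n\epsilon_n$. -/

import Mathlib

open MeasureTheory ProbabilityTheory InformationTheory Filter Topology Asymptotics
open scoped ENNReal

noncomputable section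

namespace MarkovPACBayes

/-! ### General state space Markov chains -/

section Chains

variable {S : Type*} [MeasurableSpace S]

/-- The law on the path space `ℕ → S` of the time-homogeneous Markov chain with transition
kernel `κ` started at `x`. -/
def pathFrom (κ : Kernel S S) [IsMarkovKernel κ] (x : S) : Measure (ℕ → S) :=
  Kernel.traj (X := fun _ => S)
    (fun n => κ.comap (fun h : (Finset.Iic n → S) => h ⟨n, Finset.mem_Iic.2 le_rfl⟩)
      (measurable_pi_apply _)) 0 (fun _ => x)

/-- `κ` is positive Harris with invariant probability measure `π`: for some nonzero σ-finite
measure `φ`, every set charged by `φ` is visited infinitely often, almost surely, from every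
starting point; and `π` is an invariant probability measure. -/
def IsPositiveHarris (κ : Kernel S S) [IsMarkovKernel κ] (π : Measure S) : Prop :=
  IsProbabilityMeasure π ∧ κ.Invariant π ∧
    ∃ φ : Measure S, SigmaFinite φ ∧ φ ≠ 0 ∧
      ∀ A : Set S, MeasurableSet A → φ A ≠ 0 →
        ∀ x, ∀ᵐ ω ∂(pathFrom κ x), ∃ᶠ n in atTop, ω n ∈ A

/-- Aperiodicity of a positive Harris chain with invariant law `π` (which is a maximal
irreducibility measure): there is no cycle of `d ≥ 2` disjoint sets `D 0 → D 1 → ⋯ → D 0`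
that is traversed with probability one and whose union has full `π`-measure. -/
def IsAperiodic (κ : Kernel S S) (π : Measure S) : Prop :=
  ∀ d : ℕ, 2 ≤ d → ¬ ∃ D : ZMod d → Set S,
    (∀ i, MeasurableSet (D i)) ∧ Pairwise (fun i j => Disjoint (D i) (D j)) ∧
      (∀ i, ∀ x ∈ D i, κ x (D (i + 1)) = 1) ∧ π (⋃ i, D i)ᶜ = 0

/-- The `f`-norm `sup_{|g| < f} |∫ g d(μ - ν)|` of the difference of two finite measures; the
supremum runs over the measurable `g` with `|g| < f` for which both integrals exist. -/
def fNormSub (f : S → ℝ) (μ ν : Measure S) : ℝ≥0∞ :=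
  ⨆ (g : S → ℝ) (_ : Measurable g) (_ : ∀ x, |g x| < f x) (_ : Integrable g μ)
    (_ : Integrable g ν), ENNReal.ofReal |∫ x, g x ∂μ - ∫ x, g x ∂ν|

/-- `V`-geometric ergodicity: the chain is positive Harris, `π(V) < ∞`, and the `n`-step
transition probabilities satisfy `‖κⁿ(x, ·) - π‖_V ≤ R V(x) r⁻ⁿ` for some `r > 1`, `R < ∞`. -/
def IsVGeometricallyErgodic (κ : Kernel S S) [IsMarkovKernel κ] (π : Measure S)
    (V : S → ℝ) : Prop :=
  IsPositiveHarris κ π ∧ ∫⁻ x, ENNReal.ofReal (V x) ∂π < ∞ ∧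
    ∃ r R : ℝ, 1 < r ∧ ∀ (x : S) (n : ℕ),
      fNormSub V ((κ ^ n) x) π ≤ ENNReal.ofReal (R * V x * (r ^ n)⁻¹)

end Chains

/-! ### Parametrized Markov models -/

/-- `g` is a probability density with respect to `μ`. -/
structure IsProbDensity {S : Type*} [MeasurableSpace S] (μ : Measure S) (g : S → ℝ) : Prop where
  measurable : Measurable g
  nonneg : ∀ x, 0 ≤ g x
  lintegral_eq_one : ∫⁻ x, ENNReal.ofReal (g x) ∂μ = 1

/-- A family of Markov transition densities `p θ y x = p_θ(y | x)` with respect to a reference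
measure `μ` on the state space, such as Lebesgue measure on a subset of `ℝˢ` or counting measure
on a countable set. -/
structure TransitionModel (Θ S : Type*) [MeasurableSpace Θ] [MeasurableSpace S]
    (μ : Measure S) where
  p : Θ → S → S → ℝ
  measurable_p : Measurable (fun z : Θ × S × S => p z.1 z.2.1 z.2.2)
  nonneg_p : ∀ θ y x, 0 ≤ p θ y x
  lintegral_p : ∀ θ x, ∫⁻ y, ENNReal.ofReal (p θ y x) ∂μ = 1

namespace TransitionModel

variable {Θ S : Type*} [MeasurableSpace Θ] [MeasurableSpace S] {μ : Measure S} [SigmaFinite μ]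

/-- The one-step transition kernel `p_θ(y | x) μ(dy)`. -/
def kernel (m : TransitionModel Θ S μ) (θ : Θ) : Kernel S S :=
  Kernel.withDensity (Kernel.const S μ) (fun x y => ENNReal.ofReal (m.p θ y x))

theorem kernel_apply (m : TransitionModel Θ S μ) (θ : Θ) (x : S) :
    m.kernel θ x = μ.withDensity fun y => ENNReal.ofReal (m.p θ y x) := by
  have h : Measurable (Function.uncurry fun x y => ENNReal.ofReal (m.p θ y x)) :=
    (m.measurable_p.comp
      (by fun_prop : Measurable fun z : S × S => (θ, z.2, z.1))).ennreal_ofReal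
  rw [kernel, Kernel.withDensity_apply _ h, Kernel.const_apply]

instance (m : TransitionModel Θ S μ) (θ : Θ) : IsMarkovKernel (m.kernel θ) :=
  ⟨fun x => ⟨by rw [kernel_apply, withDensity_apply _ .univ, setLIntegral_univ, m.lintegral_p]⟩⟩

/-- The joint density `p_θ^{(n)}(x₀, …, xₙ) = q⁽⁰⁾(x₀) ∏ p_θ(x_{i+1} | x_i)`. -/
def jointDensity (m : TransitionModel Θ S μ) (q₀ : S → ℝ) (θ : Θ) (n : ℕ)
    (x : Fin (n + 1) → S) : ℝ :=
  q₀ (x 0) * ∏ i : Fin n, m.p θ (x i.succ) (x i.castSucc)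

/-- The law `P_θ^{(n)}` of `(X₀, …, Xₙ)`. -/
def law (m : TransitionModel Θ S μ) (q₀ : S → ℝ) (θ : Θ) (n : ℕ) :
    Measure (Fin (n + 1) → S) :=
  (Measure.pi fun _ => μ).withDensity fun x => ENNReal.ofReal (m.jointDensity q₀ θ n x)

/-- The log-likelihood ratio `r_n(θ, θ₀) = log (p_{θ₀}^{(n)} / p_θ^{(n)})`. -/
def logRatio (m : TransitionModel Θ S μ) (q₀ : S → ℝ) (θ θ₀ : Θ) (n : ℕ)
    (x : Fin (n + 1) → S) : ℝ :=
  Real.log (m.jointDensity q₀ θ₀ n x / m.jointDensity q₀ θ n x)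

end TransitionModel

/-- The law with density `q` with respect to `μ`. -/
def densityLaw {S : Type*} [MeasurableSpace S] (μ : Measure S) (q : S → ℝ) : Measure S :=
  μ.withDensity fun x => ENNReal.ofReal (q x)

/-- `|log a - log b| ≤ c` for `a, b ≥ 0`, where `log 0 = -∞` and `|log 0 - log 0| = 0`. -/
def LogClose (a b c : ℝ) : Prop :=
  (a = 0 ↔ b = 0) ∧ |Real.log a - Real.log b| ≤ c

/-- The generalized Lipschitz assumption with exponent `δ`, for the transition densities and the
invariant densities `q θ` of a model with true parameter `θ₀`, the functions
`M1 k y x = M⁽¹⁾_k(y, x)`, `M2`, `f1`, `f2`, and the measures `ρ n`. -/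
structure GenLip {Θ S : Type*} [MeasurableSpace Θ] [MeasurableSpace S] {μ : Measure S}
    (m : TransitionModel Θ S μ) (q : Θ → S → ℝ) (θ₀ : Θ) (δ : ℝ) {K : ℕ}
    (M1 : Fin K → S → S → ℝ) (M2 : Fin K → S → ℝ) (f1 f2 : Fin K → Θ → Θ → ℝ)
    (ρ : ℕ → ProbabilityMeasure Θ) : Prop where
  measurable_M1 : ∀ k, Measurable (fun z : S × S => M1 k z.1 z.2)
  measurable_M2 : ∀ k, Measurable (M2 k)
  measurable_f1 : ∀ k, Measurable (fun θ => f1 k θ θ₀)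
  measurable_f2 : ∀ k, Measurable (fun θ => f2 k θ θ₀)
  nonneg_M1 : ∀ k y x, 0 ≤ M1 k y x
  nonneg_M2 : ∀ k x, 0 ≤ M2 k x
  lip_transition : ∀ θ₁ θ₂ y x,
    LogClose (m.p θ₁ y x) (m.p θ₂ y x) (∑ k, M1 k y x * |f1 k θ₂ θ₁|)
  lip_invariant : ∀ θ₁ θ₂ x,
    LogClose (q θ₁ x) (q θ₂ x) (∑ k, M2 k x * |f2 k θ₂ θ₁|)
  moment_f1 : ∃ C : Fin K → ℝ, ∀ k, ∀ n : ℕ, 1 ≤ n →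
    ∫⁻ θ, ENNReal.ofReal (|f1 k θ θ₀| ^ (2 + δ)) ∂(ρ n : Measure Θ) < ENNReal.ofReal (C k / n)
  moment_f2 : ∃ C : Fin K → ℝ, ∀ k, ∀ n : ℕ, 1 ≤ n →
    ∫⁻ θ, ENNReal.ofReal (|f2 k θ θ₀| ^ (2 + δ)) ∂(ρ n : Measure Θ) < ENNReal.ofReal (C k / n)
  moment_M1 : ∃ B : ℝ, ∀ k θ,
    ∫⁻ x, ∫⁻ y, ENNReal.ofReal (M1 k y x ^ (2 + δ) * m.p θ y x * q θ x) ∂μ ∂μ < ENNReal.ofReal B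

/-- The three conditions of the PAC-Bayes bound at sample size `n`, with rate `ε > 0` and
`ρ ∈ F`, for the prior `π`, the known initial density `q₀` and the true parameter `θ₀`. The fields
between `mem` and `kl_le` say that the expectations in the first condition exist and that it can be
read either through the Kullback-Leibler divergence or through `E[r_n(θ, θ₀)]`. -/
structure PACBayesConditions {Θ S : Type*} [MeasurableSpace Θ] [MeasurableSpace S]
    {μ : Measure S} [SigmaFinite μ] (m : TransitionModel Θ S μ) (q₀ : S → ℝ) (θ₀ : Θ)
    (π : Measure Θ) (F : Set (ProbabilityMeasure Θ)) (n : ℕ) (ε : ℝ)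
    (ρ : ProbabilityMeasure Θ) : Prop where
  pos : 0 < ε
  mem : ρ ∈ F
  integrable_logRatio : ∀ θ, Integrable (m.logRatio q₀ θ θ₀ n) (m.law q₀ θ₀ n)
  kl_eq : ∀ θ, klDiv (m.law q₀ θ₀ n) (m.law q₀ θ n) =
    ENNReal.ofReal (∫ x, m.logRatio q₀ θ θ₀ n x ∂(m.law q₀ θ₀ n))
  integrable_expectation :
    Integrable (fun θ => ∫ x, m.logRatio q₀ θ θ₀ n x ∂(m.law q₀ θ₀ n)) (ρ : Measure Θ)
  expectation_le :
    ∫ θ, ∫ x, m.logRatio q₀ θ θ₀ n x ∂(m.law q₀ θ₀ n) ∂(ρ : Measure Θ) ≤ n * ε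
  kl_le : ∫⁻ θ, klDiv (m.law q₀ θ₀ n) (m.law q₀ θ n) ∂(ρ : Measure Θ) ≤ ENNReal.ofReal (n * ε)
  variance_le : ∫⁻ θ, evariance (m.logRatio q₀ θ θ₀ n) (m.law q₀ θ₀ n) ∂(ρ : Measure Θ) ≤
    ENNReal.ofReal (n * ε)
  prior_le : klDiv (ρ : Measure Θ) π ≤ ENNReal.ofReal (n * ε)

end MarkovPACBayes

end

open MarkovPACBayes

/-! Put `s = ∑ k, |f1 k θ θ₀|`. One-step log-densities at `θ` and `θ₀` differ by at most `s * M` for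
an envelope `M ≥ 1` of the `M1 k`. Bounding the mean log-ratio by `n * s` alone would be too weak
for small `δ`, since `s` is only of order `n^(-1/(2+δ))` under `ρ n`. Two gains over this bound give
the rate.

Stationary drift. Since `a log (a/b) ≤ a - b + (a+b) c²` and `a - b` integrates to zero, the
one-step divergence at `x` is of order `s²`, with second moments of `M` under both kernels. The
moment under the kernel of `θ` is known only on average under `q θ`, whereas the average needed is
under `q θ₀`. Where `q θ₀ ≤ 2 q θ` it transfers at the cost of a factor 2. The complement has `q
θ₀`-mass `O(s log (1/s))`, because the two invariant laws are that close, and there a truncated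
first-order bound is enough. In total the stationary mean is `O(s^(3/2))`
(`exists_integral_stepLog_le`), and 3/2 is just large enough (`rpow_exponent_le_max`).

Closeness of the invariant laws (`exists_measure_le`). Replacing `j` steps of the `θ`-chain by steps
of the `θ₀`-chain costs `s * B` each, and after `j ~ log (1/s)` steps the `θ₀`-chain has forgotten
its start up to `s * V`. Since `V` need not be integrable under the law of `θ`, a drift function `U`
and the entropy inequality applied to `log (1 + s U)` control `V / (1 + s U)` instead
(`lintegral_drift_le`), which suffices.

Fluctuations. The log-ratio minus `n` times the stationary mean, corrected by truncated solutions of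
the Poisson equation, behaves like a martingale with increments of squared size `O(s² V)`. Hence its
mean is `O(s)` and its second moment is `O(n s²)` (`exists_sumLog_bounds`).

Integrating powers of `s` against `ρ n` by interpolation from the moment of order `2 + δ` finishes
the proof. -/

namespace MarkovPACBayes

set_option linter.unusedSectionVars false

/-! ### Kernel powers and consequences of geometric ergodicity -/

section GeometricErgodicity

variable {S : Type*} [MeasurableSpace S]

theorem isMarkovKernel_pow (κ : Kernel S S) [IsMarkovKernel κ] (n : ℕ) :
    IsMarkovKernel (κ ^ n) := by
  induction n with
  | zero => rw [pow_zero]; exact inferInstanceAs (IsMarkovKernel Kernel.id)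
  | succ n ih => rw [pow_succ]; exact inferInstanceAs (IsMarkovKernel ((κ ^ n) ∘ₖ κ))

theorem lintegral_pow_succ (κ : Kernel S S) (n : ℕ) (x : S) {f : S → ℝ≥0∞}
    (hf : Measurable f) :
    ∫⁻ y, f y ∂((κ ^ (n + 1)) x) = ∫⁻ z, ∫⁻ y, f y ∂((κ ^ n) z) ∂(κ x) := by
  rw [pow_succ]
  exact Kernel.lintegral_comp _ _ _ hf

theorem lintegral_pow_succ' (κ : Kernel S S) (n : ℕ) (x : S) {f : S → ℝ≥0∞}
    (hf : Measurable f) :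
    ∫⁻ y, f y ∂((κ ^ (n + 1)) x) = ∫⁻ z, ∫⁻ y, f y ∂(κ z) ∂((κ ^ n) x) := by
  rw [pow_succ']
  exact Kernel.lintegral_comp _ _ _ hf

theorem integral_pow_succ (κ : Kernel S S) (n : ℕ) (x : S) {f : S → ℝ}
    (hf : Integrable f ((κ ^ (n + 1)) x)) :
    ∫ y, f y ∂((κ ^ (n + 1)) x) = ∫ z, ∫ y, f y ∂((κ ^ n) z) ∂(κ x) := by
  rw [pow_succ] at hf ⊢
  exact Kernel.integral_comp hf

theorem integrable_integral_pow (κ : Kernel S S) (n : ℕ) (x : S) {f : S → ℝ}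
    (hf : Integrable f ((κ ^ (n + 1)) x)) :
    Integrable (fun z => ∫ y, f y ∂((κ ^ n) z)) (κ x) := by
  rw [pow_succ] at hf
  exact MeasureTheory.Integrable.integral_comp hf

theorem integral_pow_zero (κ : Kernel S S) (x : S) {f : S → ℝ} (hf : Measurable f) :
    ∫ y, f y ∂((κ ^ 0) x) = f x := by
  rw [pow_zero]
  change ∫ y, f y ∂(Kernel.id x) = f x
  rw [Kernel.id_apply, integral_dirac' _ _ hf.stronglyMeasurable]

theorem lintegral_pow_zero (κ : Kernel S S) (x : S) {f : S → ℝ≥0∞} (hf : Measurable f) :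
    ∫⁻ y, f y ∂((κ ^ 0) x) = f x := by
  rw [pow_zero]
  change ∫⁻ y, f y ∂(Kernel.id x) = f x
  rw [Kernel.id_apply, lintegral_dirac' _ hf]

/-- Monotone convergence along truncations. -/
theorem lintegral_ofReal_le_of_truncation {ν : Measure S} {f : S → ℝ} (hf : Measurable f)
    {c : ℝ≥0∞} (h : ∀ N : ℕ, ∫⁻ x, ENNReal.ofReal (min (f x) N) ∂ν ≤ c) :
    ∫⁻ x, ENNReal.ofReal (f x) ∂ν ≤ c := by
  have h1 : ∀ x, ENNReal.ofReal (f x) = ⨆ N : ℕ, ENNReal.ofReal (min (f x) N) := by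
    intro x
    apply le_antisymm
    · obtain ⟨N, hN⟩ := exists_nat_ge (f x)
      refine le_trans ?_ (le_iSup _ N)
      rw [min_eq_left hN]
    · exact iSup_le fun N => ENNReal.ofReal_le_ofReal (min_le_left _ _)
  simp_rw [h1]
  rw [lintegral_iSup]
  · exact iSup_le h
  · intro N; exact (hf.min measurable_const).ennreal_ofReal
  · intro N N' hN x
    exact ENNReal.ofReal_le_ofReal (min_le_min le_rfl (by exact_mod_cast hN))

/-- Geometric convergence in `V`-norm, tested on functions dominated by `V`. -/
structure GeomErg (κ : Kernel S S) (Q : Measure S) (V : S → ℝ) (r R : ℝ) : Prop where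
  measurable_V : Measurable V
  one_le_V : ∀ x, 1 ≤ V x
  one_lt_r : 1 < r
  one_le_R : 1 ≤ R
  integrable_V : Integrable V Q
  abs_sub_le : ∀ (x : S) (n : ℕ) (g : S → ℝ), Measurable g → (∀ y, |g y| ≤ V y) →
    Integrable g ((κ ^ n) x) → |∫ y, g y ∂((κ ^ n) x) - ∫ y, g y ∂Q| ≤ R * V x * (r ^ n)⁻¹

/-- The supremum in `fNormSub` runs over `|g| < V` strictly, so the bound is applied to `g / 2`, at
the price of a factor 2 in the constant. Integrability under the invariant law is automatic from
`|g| ≤ V`. -/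
theorem IsVGeometricallyErgodic.exists_geomErg {κ : Kernel S S} [IsMarkovKernel κ]
    {Q : Measure S} {V : S → ℝ} (h : IsVGeometricallyErgodic κ Q V) (hVm : Measurable V)
    (hV1 : ∀ x, 1 ≤ V x) : ∃ r R : ℝ, GeomErg κ Q V r R := by
  obtain ⟨-, hQ, r, R, hr, hR⟩ := h
  have hVi : Integrable V Q := by
    refine ⟨hVm.aestronglyMeasurable, ?_⟩
    rw [hasFiniteIntegral_iff_ofReal (ae_of_all _ fun x => zero_le_one.trans (hV1 x))]
    exact hQ
  refine ⟨r, 2 * (|R| + 1), hVm, hV1, hr, by linarith [abs_nonneg R], hVi, ?_⟩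
  intro x n g hg hgV hgi
  have hgQ : Integrable g Q := hVi.mono' hg.aestronglyMeasurable
    (ae_of_all _ fun y => by simpa using hgV y)
  have hrn : 0 < (r ^ n)⁻¹ := by positivity
  have hVx : 0 < V x := zero_lt_one.trans_le (hV1 x)
  have h1 : ENNReal.ofReal |∫ y, g y / 2 ∂((κ ^ n) x) - ∫ y, g y / 2 ∂Q| ≤
      ENNReal.ofReal (R * V x * (r ^ n)⁻¹) := by
    refine le_trans ?_ (hR x n)
    unfold fNormSub
    refine le_trans ?_ (le_iSup _ fun y => g y / 2)
    refine le_trans ?_ (le_iSup _ (hg.div_const 2))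
    refine le_trans ?_ (le_iSup _ fun y => by
      rw [abs_div, abs_two]
      linarith [hgV y, hV1 y])
    refine le_trans ?_ (le_iSup _ (hgi.div_const 2))
    exact le_iSup (fun _ : Integrable (fun y => g y / 2) Q =>
      ENNReal.ofReal |∫ y, g y / 2 ∂((κ ^ n) x) - ∫ y, g y / 2 ∂Q|) (hgQ.div_const 2)
  have h2 : |∫ y, g y / 2 ∂((κ ^ n) x) - ∫ y, g y / 2 ∂Q| ≤ (|R| + 1) * V x * (r ^ n)⁻¹ := by
    rw [← ENNReal.ofReal_le_ofReal_iff (by positivity)]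
    refine h1.trans (ENNReal.ofReal_le_ofReal ?_)
    gcongr
    linarith [le_abs_self R]
  rw [integral_div, integral_div, ← sub_div, abs_div, abs_two] at h2
  linarith

namespace GeomErg

variable {κ : Kernel S S} [IsMarkovKernel κ] {Q : Measure S} [IsProbabilityMeasure Q]
  {V : S → ℝ} {r R : ℝ}

theorem V_pos (h : GeomErg κ Q V r R) (x : S) : 0 < V x := zero_lt_one.trans_le (h.one_le_V x)

theorem r_pos (h : GeomErg κ Q V r R) : 0 < r := zero_lt_one.trans h.one_lt_r

theorem R_pos (h : GeomErg κ Q V r R) : 0 < R := zero_lt_one.trans_le h.one_le_R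

theorem one_le_integral (h : GeomErg κ Q V r R) : 1 ≤ ∫ y, V y ∂Q := by
  have := integral_mono (μ := Q) (integrable_const (1 : ℝ)) h.integrable_V h.one_le_V
  simpa using this

/-- `V` itself is not yet known to be integrable under `κ ^ n`, so it is not an admissible test
function. Its truncations `min V N` are, with bounds uniform in `N`. -/
theorem lintegral_V_pow_le (h : GeomErg κ Q V r R) (n : ℕ) (x : S) :
    ∫⁻ y, ENNReal.ofReal (V y) ∂((κ ^ n) x) ≤
      ENNReal.ofReal ((∫ y, V y ∂Q) + R * V x * (r ^ n)⁻¹) := by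
  have := isMarkovKernel_pow κ n
  apply lintegral_ofReal_le_of_truncation h.measurable_V
  intro N
  have hm : Measurable fun y => min (V y) (N : ℝ) := h.measurable_V.min measurable_const
  have h0 : ∀ y, 0 ≤ min (V y) (N : ℝ) := fun y => le_min (h.V_pos y).le (Nat.cast_nonneg _)
  have hi : Integrable (fun y => min (V y) (N : ℝ)) ((κ ^ n) x) := by
    refine Integrable.of_bound hm.aestronglyMeasurable N (ae_of_all _ fun y => ?_)
    rw [Real.norm_eq_abs, abs_of_nonneg (h0 y)]
    exact min_le_right _ _
  have hiQ : Integrable (fun y => min (V y) (N : ℝ)) Q := by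
    refine Integrable.of_bound hm.aestronglyMeasurable N (ae_of_all _ fun y => ?_)
    rw [Real.norm_eq_abs, abs_of_nonneg (h0 y)]
    exact min_le_right _ _
  rw [← ofReal_integral_eq_lintegral_ofReal hi (ae_of_all _ h0)]
  apply ENNReal.ofReal_le_ofReal
  have h1 := h.abs_sub_le x n _ hm (fun y => by
    rw [abs_of_nonneg (h0 y)]; exact min_le_left _ _) hi
  have h2 : ∫ y, min (V y) (N : ℝ) ∂Q ≤ ∫ y, V y ∂Q :=
    integral_mono hiQ h.integrable_V fun y => min_le_left _ _
  linarith [le_abs_self (∫ y, min (V y) (N : ℝ) ∂((κ ^ n) x) - ∫ y, min (V y) (N : ℝ) ∂Q)]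

theorem integrable_V_pow (h : GeomErg κ Q V r R) (n : ℕ) (x : S) :
    Integrable V ((κ ^ n) x) := by
  refine ⟨h.measurable_V.aestronglyMeasurable, ?_⟩
  rw [hasFiniteIntegral_iff_ofReal (ae_of_all _ fun x => (h.V_pos x).le)]
  exact (h.lintegral_V_pow_le n x).trans_lt ENNReal.ofReal_lt_top

theorem integral_V_pow_le (h : GeomErg κ Q V r R) (n : ℕ) (x : S) :
    ∫ y, V y ∂((κ ^ n) x) ≤ (∫ y, V y ∂Q) + R * V x * (r ^ n)⁻¹ := by
  have h1 := h.lintegral_V_pow_le n x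
  rw [← ofReal_integral_eq_lintegral_ofReal (h.integrable_V_pow n x)
    (ae_of_all _ fun x => (h.V_pos x).le)] at h1
  have h2 := h.one_le_integral
  have := h.V_pos x
  have := h.R_pos
  have := h.r_pos
  exact (ENNReal.ofReal_le_ofReal_iff (by positivity)).1 h1

theorem integral_V_pow_le' (h : GeomErg κ Q V r R) (n : ℕ) (x : S) :
    ∫ y, V y ∂((κ ^ n) x) ≤ ((∫ y, V y ∂Q) + R) * V x := by
  have h1 := h.integral_V_pow_le n x
  have h2 := h.one_le_integral
  have h3 := h.one_le_V x
  have h5 : (r ^ n)⁻¹ ≤ 1 := inv_le_one_of_one_le₀ (one_le_pow₀ h.one_lt_r.le)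
  have h6 : R * V x * (r ^ n)⁻¹ ≤ R * V x :=
    mul_le_of_le_one_right (mul_nonneg h.R_pos.le (h.V_pos x).le) h5
  nlinarith

theorem integral_V_le (h : GeomErg κ Q V r R) (x : S) :
    ∫ y, V y ∂(κ x) ≤ ((∫ y, V y ∂Q) + R) * V x := by
  simpa using h.integral_V_pow_le' 1 x

theorem integrable_V_kernel (h : GeomErg κ Q V r R) (x : S) : Integrable V (κ x) := by
  simpa using h.integrable_V_pow 1 x

/-- A drift function for the one-step kernel. -/
theorem exists_drift (h : GeomErg κ Q V r R) :
    ∃ (U : S → ℝ) (c : ℝ), Measurable U ∧ 1 ≤ c ∧ (∀ x, 0 ≤ U x) ∧ (∀ x, U x ≤ c * V x) ∧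
      (∀ x, Integrable U (κ x)) ∧
      ∀ x, ∫ y, U y ∂(κ x) ≤ U x - V x / 2 + ∫ y, V y ∂Q := by
  -- With this `k`, the `k`-step mean of `V` is at most `V / 2` plus its stationary mean. For `U =
  -- ∑_{i<k} κ^i V` the sum telescopes, `κ U = U - V + κ^k V`, which is the drift inequality.
  obtain ⟨k, hk⟩ : ∃ k : ℕ, 2 * R ≤ r ^ k :=
    (pow_unbounded_of_one_lt (2 * R) h.one_lt_r).imp fun _ => le_of_lt
  have hi : ∀ i x, Integrable (fun z => ∫ y, V y ∂((κ ^ i) z)) (κ x) := fun i x =>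
    integrable_integral_pow κ i x (h.integrable_V_pow _ x)
  have hv := h.one_le_integral
  refine ⟨fun x => ∑ i ∈ Finset.range k, ∫ y, V y ∂((κ ^ i) x),
    k * ((∫ y, V y ∂Q) + R) + 1, ?_, ?_, ?_, ?_, ?_, ?_⟩
  · refine Finset.measurable_sum _ fun i _ => ?_
    have := isMarkovKernel_pow κ i
    exact (h.measurable_V.stronglyMeasurable.integral_kernel (κ := κ ^ i)).measurable
  · have := h.R_pos
    have : 0 ≤ (k : ℝ) * ((∫ y, V y ∂Q) + R) := by positivity
    linarith
  · exact fun x => Finset.sum_nonneg fun i _ => integral_nonneg fun y => (h.V_pos y).le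
  · intro x
    calc ∑ i ∈ Finset.range k, ∫ y, V y ∂((κ ^ i) x)
        ≤ ∑ i ∈ Finset.range k, ((∫ y, V y ∂Q) + R) * V x :=
          Finset.sum_le_sum fun i _ => h.integral_V_pow_le' i x
      _ ≤ _ := by
        rw [Finset.sum_const, Finset.card_range, nsmul_eq_mul]
        nlinarith [h.V_pos x]
  · exact fun x => integrable_finsetSum _ fun i _ => hi i x
  · intro x
    rw [integral_finsetSum _ fun i _ => hi i x]
    have h1 : ∀ i ∈ Finset.range k, ∫ z, ∫ y, V y ∂((κ ^ i) z) ∂(κ x) =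
        ∫ y, V y ∂((κ ^ (i + 1)) x) := fun i _ =>
      (integral_pow_succ κ i x (h.integrable_V_pow _ x)).symm
    rw [Finset.sum_congr rfl h1]
    have h2 := Finset.sum_range_succ' (fun i => ∫ y, V y ∂((κ ^ i) x)) k
    rw [Finset.sum_range_succ] at h2
    rw [integral_pow_zero κ x h.measurable_V] at h2
    have h3 := h.integral_V_pow_le k x
    have h4 : R * V x * (r ^ k)⁻¹ ≤ V x / 2 := by
      have hrk : 0 < r ^ k := pow_pos h.r_pos k
      rw [← div_eq_mul_inv, div_le_iff₀ hrk]
      nlinarith [h.V_pos x]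
    linarith

theorem integrable_sqrt_V {P : Measure S} [IsFiniteMeasure P] (h : GeomErg κ Q V r R)
    (hP : Integrable V P) : Integrable (fun y => √(V y)) P := by
  refine hP.mono' (h.measurable_V.sqrt).aestronglyMeasurable (ae_of_all _ fun y => ?_)
  rw [Real.norm_eq_abs, abs_of_nonneg (Real.sqrt_nonneg _)]
  rw [Real.sqrt_le_left (h.V_pos y).le]
  nlinarith [h.one_le_V y]

/-- Jensen's inequality, obtained from the arithmetic-geometric bound `√V ≤ √b / 2 + V / (2√b)`. -/
theorem integral_sqrt_V_le {P : Measure S} [IsProbabilityMeasure P] (h : GeomErg κ Q V r R)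
    (hP : Integrable V P) {b : ℝ} (hb0 : 0 < b) (hb : ∫ y, V y ∂P ≤ b) :
    ∫ y, √(V y) ∂P ≤ √b := by
  have hsb : 0 < √b := Real.sqrt_pos.2 hb0
  have h1 : ∀ y, √(V y) ≤ √b / 2 + V y / (2 * √b) := by
    intro y
    have h2 := Real.sq_sqrt (h.V_pos y).le
    have h3 : 0 ≤ (√(V y) - √b) ^ 2 / (2 * √b) := by positivity
    have h4 : (√(V y) - √b) ^ 2 / (2 * √b) = V y / (2 * √b) + √b / 2 - √(V y) := by
      rw [← h2]; simp only [Real.sqrt_sq (Real.sqrt_nonneg _)]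
      field_simp; ring
    linarith
  have hi : Integrable (fun y => √b / 2 + V y / (2 * √b)) P :=
    (integrable_const _).add (hP.div_const _)
  calc ∫ y, √(V y) ∂P ≤ ∫ y, (√b / 2 + V y / (2 * √b)) ∂P :=
        integral_mono (h.integrable_sqrt_V hP) hi h1
    _ = √b / 2 + (∫ y, V y ∂P) / (2 * √b) := by
        rw [integral_add (integrable_const _) (hP.div_const _), integral_const, integral_div]; simp
    _ ≤ √b / 2 + b / (2 * √b) := by gcongr
    _ = √b := by
        have := Real.mul_self_sqrt hb0.le
        field_simp
        linarith

theorem abs_integral_le {P : Measure S} [IsProbabilityMeasure P] (h : GeomErg κ Q V r R)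
    (hP : Integrable V P) {b : ℝ} (hb0 : 0 < b) (hb : ∫ y, V y ∂P ≤ b) {g : S → ℝ} {c : ℝ}
    (hc : 0 ≤ c) (hgV : ∀ y, |g y| ≤ c * √(V y)) : |∫ y, g y ∂P| ≤ c * √b := by
  calc |∫ y, g y ∂P| ≤ ∫ y, |g y| ∂P := abs_integral_le_integral_abs
    _ ≤ ∫ y, c * √(V y) ∂P := integral_mono_of_nonneg (ae_of_all _ fun y => abs_nonneg _)
        ((h.integrable_sqrt_V hP).const_mul c) (ae_of_all _ hgV)
    _ = c * ∫ y, √(V y) ∂P := integral_const_mul _ _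
    _ ≤ c * √b := by gcongr; exact h.integral_sqrt_V_le hP hb0 hb

theorem integrable_of_abs_le {P : Measure S} [IsFiniteMeasure P] (h : GeomErg κ Q V r R)
    (hP : Integrable V P) {g : S → ℝ} {c : ℝ}
    (hg : Measurable g) (hgV : ∀ y, |g y| ≤ c * √(V y)) : Integrable g P :=
  ((h.integrable_sqrt_V hP).const_mul c).mono' hg.aestronglyMeasurable (ae_of_all _ hgV)

/-- Geometric convergence at the scale `√V`. -/
theorem abs_sub_le_sqrt (h : GeomErg κ Q V r R) {g : S → ℝ} {c : ℝ} (hc : 0 ≤ c)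
    (hg : Measurable g) (hgV : ∀ y, |g y| ≤ c * √(V y)) (x : S) (n : ℕ) :
    |∫ y, g y ∂((κ ^ n) x) - ∫ y, g y ∂Q| ≤
      c * (2 * √((∫ y, V y ∂Q) + 1) * √R) * √(V x) * ((√r)⁻¹) ^ n := by
  have := isMarkovKernel_pow κ n
  have hr := h.r_pos
  have hR := h.R_pos
  have hV := h.V_pos x
  have hv := h.one_le_integral
  set v := ∫ y, V y ∂Q with hvdef
  set t := R * V x * (r ^ n)⁻¹ with ht
  have ht0 : 0 < t := by positivity
  have hst : √t = √R * √(V x) * ((√r)⁻¹) ^ n := by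
    have hrn : √(r ^ n) = √r ^ n := by
      rw [Real.sqrt_eq_iff_mul_self_eq (by positivity) (by positivity), ← mul_pow,
        Real.mul_self_sqrt hr.le]
    rw [ht, Real.sqrt_mul (by positivity), Real.sqrt_mul hR.le, Real.sqrt_inv, hrn, inv_pow]
  have key : |∫ y, g y ∂((κ ^ n) x) - ∫ y, g y ∂Q| ≤ c * (2 * √(v + 1)) * √t := by
    have hone : 1 ≤ √(v + 1) := by rw [Real.one_le_sqrt]; linarith
    -- If `t ≤ 1`, then `|g| ≤ c √V ≤ c V` and the ergodic bound gives `c t ≤ c √t`. If `t > 1`,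
    -- both means are bounded separately by Jensen, as `V` has mean at most `v + t ≤ (v + 1) t`. The
    -- price of passing to `√V` is the slower rate `√r`.
    rcases le_or_gt t 1 with h1 | h1
    · have h2 : |∫ y, g y ∂((κ ^ n) x) - ∫ y, g y ∂Q| ≤ c * t := by
        rcases hc.eq_or_lt with rfl | hc'
        · have : ∀ y, g y = 0 := fun y => by simpa using hgV y
          simp [this]
        have h3 := h.abs_sub_le x n (fun y => g y / c) (hg.div_const c) (fun y => by
          rw [abs_div, abs_of_pos hc', div_le_iff₀ hc']
          refine (hgV y).trans ?_
          rw [mul_comm]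
          gcongr
          rw [Real.sqrt_le_left (h.V_pos y).le]
          nlinarith [h.one_le_V y])
          ((h.integrable_of_abs_le (h.integrable_V_pow n x) hg hgV).div_const c)
        rw [integral_div, integral_div, ← sub_div, abs_div, abs_of_pos hc',
          div_le_iff₀ hc'] at h3
        linarith
      have h4 : t ≤ √t := by
        apply Real.le_sqrt_of_sq_le
        nlinarith
      have h5 : 0 ≤ √t := Real.sqrt_nonneg _
      calc _ ≤ c * t := h2
        _ ≤ c * √t := by gcongr
        _ = c * 1 * √t := by ring
        _ ≤ _ := by gcongr; linarith
    · have h2 : |∫ y, g y ∂((κ ^ n) x)| ≤ c * √((v + 1) * t) :=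
        h.abs_integral_le (h.integrable_V_pow n x) (by positivity)
          ((h.integral_V_pow_le n x).trans (by nlinarith)) hc hgV
      have h3 : |∫ y, g y ∂Q| ≤ c * √((v + 1) * t) :=
        h.abs_integral_le h.integrable_V (by positivity) (by nlinarith) hc hgV
      rw [Real.sqrt_mul (by positivity)] at h2 h3
      have := abs_sub (∫ y, g y ∂((κ ^ n) x)) (∫ y, g y ∂Q)
      linarith
  rw [hst] at key
  linarith

end GeomErg

/-! ### The truncated Poisson equation -/

/-- Partial sums of the solution of the Poisson equation. -/
noncomputable def poissonSum (κ : Kernel S S) (Q : Measure S) (g : S → ℝ) (k : ℕ) (x : S) : ℝ :=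
  ∑ d ∈ Finset.range k, (∫ y, g y ∂((κ ^ d) x) - ∫ y, g y ∂Q)

theorem poissonSum_zero (κ : Kernel S S) (Q : Measure S) (g : S → ℝ) (x : S) :
    poissonSum κ Q g 0 x = 0 := by simp [poissonSum]

theorem measurable_poissonSum (κ : Kernel S S) [IsMarkovKernel κ] (Q : Measure S) {g : S → ℝ}
    (hg : Measurable g) (k : ℕ) : Measurable (poissonSum κ Q g k) := by
  refine Finset.measurable_sum _ fun i _ => ?_
  have := isMarkovKernel_pow κ i
  exact (hg.stronglyMeasurable.integral_kernel (κ := κ ^ i)).measurable.sub_const _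

namespace GeomErg

variable {κ : Kernel S S} [IsMarkovKernel κ] {Q : Measure S} [IsProbabilityMeasure Q]
  {V : S → ℝ} {r R : ℝ}

/-- A geometric series of ratio `1/√r`. What matters is that `D` depends neither on `k` nor on `g`,
and that the bound is at the scale `√V`, whose square is integrable. -/
theorem exists_poissonSum_bound (h : GeomErg κ Q V r R) : ∃ D : ℝ, 0 < D ∧
    ∀ (g : S → ℝ) (c : ℝ), 0 ≤ c → Measurable g → (∀ y, |g y| ≤ c * √(V y)) →
      ∀ k x, |poissonSum κ Q g k x| ≤ c * D * √(V x) := by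
  have hr1 : (√r)⁻¹ < 1 := inv_lt_one_of_one_lt₀ (by
    rw [Real.lt_sqrt zero_le_one]; simpa using h.one_lt_r)
  have hr0 : 0 ≤ (√r)⁻¹ := by positivity
  have hR := h.R_pos
  have hv := h.one_le_integral
  refine ⟨(2 * √((∫ y, V y ∂Q) + 1) * √R) * (1 - (√r)⁻¹)⁻¹, ?_, ?_⟩
  · have : 0 < 1 - (√r)⁻¹ := by linarith
    positivity
  intro g c hc hg hgV k x
  calc |poissonSum κ Q g k x|
      ≤ ∑ d ∈ Finset.range k, |∫ y, g y ∂((κ ^ d) x) - ∫ y, g y ∂Q| :=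
        Finset.abs_sum_le_sum_abs _ _
    _ ≤ ∑ d ∈ Finset.range k,
        c * (2 * √((∫ y, V y ∂Q) + 1) * √R) * √(V x) * ((√r)⁻¹) ^ d :=
        Finset.sum_le_sum fun d _ => h.abs_sub_le_sqrt hc hg hgV x d
    _ = c * (2 * √((∫ y, V y ∂Q) + 1) * √R) * √(V x) *
        ∑ d ∈ Finset.range k, ((√r)⁻¹) ^ d := by rw [Finset.mul_sum]
    _ ≤ c * (2 * √((∫ y, V y ∂Q) + 1) * √R) * √(V x) * (1 - (√r)⁻¹)⁻¹ := by
        gcongr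
        exact (Summable.sum_le_tsum _ (fun i _ => pow_nonneg hr0 i)
          (summable_geometric_of_lt_one hr0 hr1)).trans_eq (tsum_geometric_of_lt_one hr0 hr1)
    _ = _ := by ring

/-- The Poisson equation in an exact finite form: one application of the kernel shifts the
truncation level, so no limit in `k` is ever taken. -/
theorem poissonSum_succ (h : GeomErg κ Q V r R) {g : S → ℝ} {c : ℝ}
    (hg : Measurable g) (hgV : ∀ y, |g y| ≤ c * √(V y)) (k : ℕ) (x : S) :
    poissonSum κ Q g (k + 1) x =
      g x - ∫ y, g y ∂Q + ∫ y, poissonSum κ Q g k y ∂(κ x) := by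
  have hi : ∀ n x, Integrable g ((κ ^ n) x) := fun n x => by
    have := isMarkovKernel_pow κ n
    exact h.integrable_of_abs_le (h.integrable_V_pow n x) hg hgV
  unfold poissonSum
  rw [Finset.sum_range_succ', integral_pow_zero κ x hg, integral_finsetSum]
  · rw [add_comm]
    congr 1
    refine Finset.sum_congr rfl fun d _ => ?_
    rw [integral_sub (integrable_integral_pow κ d x (hi _ x)) (integrable_const _),
      integral_pow_succ κ d x (hi _ x)]
    simp
  · exact fun d _ => (integrable_integral_pow κ d x (hi _ x)).sub (integrable_const _)

end GeomErg

end GeometricErgodicity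

/-! ### Pointwise inequalities between densities with close logarithms -/

section LogClose

variable {a b c : ℝ}

theorem LogClose.le_add (h : LogClose a b c) (ha : 0 ≤ a) (hb : 0 ≤ b) : b ≤ a + b * c := by
  rcases hb.eq_or_lt with rfl | hb'
  · simpa using ha
  have ha' : 0 < a := ha.lt_of_ne fun h0 => hb'.ne' (h.1.1 h0.symm)
  have h1 := Real.log_le_sub_one_of_pos (div_pos ha' hb')
  rw [Real.log_div ha'.ne' hb'.ne'] at h1
  have h2 := (abs_le.1 h.2).1
  have h3 : 1 - c ≤ a / b := by linarith
  rw [le_div_iff₀ hb'] at h3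
  linarith

/-- Taylor expansion in `L = log a - log b`. The first-order term `a - b` vanishes after integrating
two probability densities; the remainder is at most `a L²` when `L ≥ 0` and at most `b L²` when `L <
0`. -/
theorem LogClose.mul_log_le (h : LogClose a b c) (ha : 0 ≤ a) (hb : 0 ≤ b) :
    a * (Real.log a - Real.log b) ≤ a - b + (a + b) * c ^ 2 := by
  rcases hb.eq_or_lt with rfl | hb'
  · have : a = 0 := h.1.2 rfl
    subst this
    simp
  have ha' : 0 < a := ha.lt_of_ne fun h0 => hb'.ne' (h.1.1 h0.symm)
  have hL2 : (Real.log a - Real.log b) ^ 2 ≤ c ^ 2 := by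
    rw [← sq_abs]
    exact pow_le_pow_left₀ (abs_nonneg _) h.2 2
  set L := Real.log a - Real.log b with hL
  have hab : a = b * Real.exp L := by
    rw [hL, Real.exp_sub, Real.exp_log ha', Real.exp_log hb']
    field_simp
  have hba : b = a * Real.exp (-L) := by
    rw [hab, mul_assoc, ← Real.exp_add]; simp
  rcases le_or_gt 0 L with h0 | h0
  · have h1 : Real.exp (-L) ≤ 1 - L + L ^ 2 := by
      have h2 : (1 + L) * Real.exp (-L) ≤ 1 := by
        have := mul_le_mul_of_nonneg_right (Real.add_one_le_exp L) (Real.exp_pos (-L)).le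
        rw [← Real.exp_add] at this
        simp only [add_neg_cancel, Real.exp_zero] at this
        linarith
      have h3 : 0 < 1 + L := by linarith
      have h4 : (1 + L) * Real.exp (-L) ≤ (1 + L) * (1 - L + L ^ 2) := by nlinarith [pow_nonneg h0 3]
      exact le_of_mul_le_mul_left h4 h3
    have h2 : b ≤ a * (1 - L + L ^ 2) := by
      conv_lhs => rw [hba]
      gcongr
    nlinarith [mul_le_mul_of_nonneg_left hL2 ha, mul_nonneg hb (sq_nonneg c)]
  · have h1 : b * (1 + L) ≤ a := by
      rw [hab]
      gcongr
      linarith [Real.add_one_le_exp L]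
    nlinarith [mul_le_mul_of_nonneg_left hL2 hb, mul_nonneg ha (sq_nonneg c)]

/-- The Gibbs variational inequality before integration: it is `log t ≤ t - 1` at `t = a F / (A b)`,
multiplied by `b`. With `A = ∫ a F` the last two terms cancel on integrating. -/
theorem LogClose.entropy_le (h : LogClose a b c) (ha : 0 ≤ a) (hb : 0 ≤ b) {F A : ℝ}
    (hF : 0 < F) (hA : 0 < A) :
    b * Real.log F ≤ b * c + b * Real.log A + a * F / A - b := by
  rcases hb.eq_or_lt with rfl | hb'
  · have : a = 0 := h.1.2 rfl
    subst this
    simp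
  have ha' : 0 < a := ha.lt_of_ne fun h0 => hb'.ne' (h.1.1 h0.symm)
  have h1 := Real.log_le_sub_one_of_pos (div_pos (mul_pos ha' hF) (mul_pos hA hb'))
  rw [Real.log_div (by positivity) (by positivity), Real.log_mul ha'.ne' hF.ne',
    Real.log_mul hA.ne' hb'.ne'] at h1
  have h2 := (abs_le.1 h.2).1
  have h3 : Real.log F ≤ c + Real.log A + a * F / (A * b) - 1 := by linarith
  have h4 := mul_le_mul_of_nonneg_left h3 hb
  have h5 : b * (a * F / (A * b)) = a * F / A := by field_simp
  nlinarith

end LogClose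

/-! ### One-step comparison of two transition kernels -/

namespace TransitionModel

variable {Θ S : Type*} [MeasurableSpace Θ] [MeasurableSpace S] {μ : Measure S} [SigmaFinite μ]
  (m : TransitionModel Θ S μ)

theorem measurable_p_uncurry (θ : Θ) : Measurable fun z : S × S => m.p θ z.1 z.2 :=
  m.measurable_p.comp (by fun_prop : Measurable fun z : S × S => (θ, z.1, z.2))

theorem measurable_p_left (θ : Θ) (x : S) : Measurable fun y => m.p θ y x :=
  m.measurable_p.comp (by fun_prop : Measurable fun y : S => (θ, y, x))

theorem lintegral_kernel (θ : Θ) (x : S) {f : S → ℝ≥0∞} (hf : Measurable f) :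
    ∫⁻ y, f y ∂(m.kernel θ x) = ∫⁻ y, ENNReal.ofReal (m.p θ y x) * f y ∂μ := by
  rw [kernel_apply, lintegral_withDensity_eq_lintegral_mul _
    (m.measurable_p_left θ x).ennreal_ofReal hf]
  rfl

theorem integral_kernel (θ : Θ) (x : S) (f : S → ℝ) :
    ∫ y, f y ∂(m.kernel θ x) = ∫ y, m.p θ y x * f y ∂μ := by
  rw [kernel_apply, integral_withDensity_eq_integral_toReal_smul
    (m.measurable_p_left θ x).ennreal_ofReal (ae_of_all _ fun _ => ENNReal.ofReal_lt_top)]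
  refine integral_congr_ae (ae_of_all _ fun y => ?_)
  simp [ENNReal.toReal_ofReal (m.nonneg_p θ y x)]

theorem integrable_kernel_iff (θ : Θ) (x : S) {f : S → ℝ} :
    Integrable f (m.kernel θ x) ↔ Integrable (fun y => m.p θ y x * f y) μ := by
  rw [kernel_apply, integrable_withDensity_iff_integrable_smul'
    (m.measurable_p_left θ x).ennreal_ofReal (ae_of_all _ fun _ => ENNReal.ofReal_lt_top)]
  simp [ENNReal.toReal_ofReal (m.nonneg_p θ _ x)]

theorem integrable_p (θ : Θ) (x : S) : Integrable (fun y => m.p θ y x) μ := by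
  simpa using (m.integrable_kernel_iff θ x (f := fun _ => (1 : ℝ))).1 (integrable_const _)

theorem integral_p (θ : Θ) (x : S) : ∫ y, m.p θ y x ∂μ = 1 := by
  simpa using (m.integral_kernel θ x (fun _ => (1 : ℝ))).symm

/-- The one-step log-likelihood ratio. -/
noncomputable def stepLog (θ₀ θ : Θ) (y x : S) : ℝ := Real.log (m.p θ₀ y x) - Real.log (m.p θ y x)

theorem measurable_stepLog (θ₀ θ : Θ) : Measurable fun z : S × S => m.stepLog θ₀ θ z.1 z.2 :=
  (m.measurable_p_uncurry θ₀).log.sub (m.measurable_p_uncurry θ).log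

theorem measurable_stepLog_left (θ₀ θ : Θ) (x : S) : Measurable fun y => m.stepLog θ₀ θ y x :=
  (m.measurable_p_left θ₀ x).log.sub (m.measurable_p_left θ x).log

variable {m} {θ₀ θ : Θ} {x : S} {c : S → ℝ}

/-- A one-sided total variation bound. The error is deliberately integrated against the kernel of
`θ`, because the moments of `M` are controlled along the stationary chain of that parameter. -/
theorem lintegral_kernel_le_add (hc : ∀ y, LogClose (m.p θ₀ y x) (m.p θ y x) (c y))
    (hcm : Measurable c) {h : S → ℝ≥0∞} (hh : Measurable h) (h1 : ∀ y, h y ≤ 1) :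
    ∫⁻ y, h y ∂(m.kernel θ x) ≤
      ∫⁻ y, h y ∂(m.kernel θ₀ x) + ∫⁻ y, ENNReal.ofReal (c y) ∂(m.kernel θ x) := by
  rw [m.lintegral_kernel θ x hh, m.lintegral_kernel θ₀ x hh,
    m.lintegral_kernel θ x hcm.ennreal_ofReal,
    ← lintegral_add_left (f := fun y => ENNReal.ofReal (m.p θ₀ y x) * h y)
      ((m.measurable_p_left θ₀ x).ennreal_ofReal.mul hh)]
  refine lintegral_mono fun y => ?_
  have h2 : ENNReal.ofReal (m.p θ y x) ≤
      ENNReal.ofReal (m.p θ₀ y x) + ENNReal.ofReal (m.p θ y x) * ENNReal.ofReal (c y) := by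
    rw [← ENNReal.ofReal_mul (m.nonneg_p θ y x)]
    exact (ENNReal.ofReal_le_ofReal
      ((hc y).le_add (m.nonneg_p _ _ _) (m.nonneg_p _ _ _))).trans ENNReal.ofReal_add_le
  calc ENNReal.ofReal (m.p θ y x) * h y
      ≤ (ENNReal.ofReal (m.p θ₀ y x) + ENNReal.ofReal (m.p θ y x) * ENNReal.ofReal (c y)) * h y := by
        gcongr
    _ = ENNReal.ofReal (m.p θ₀ y x) * h y +
        ENNReal.ofReal (m.p θ y x) * ENNReal.ofReal (c y) * h y := by rw [add_mul]
    _ ≤ _ := add_le_add_right (mul_le_of_le_one_right' (h1 y)) _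

theorem ofReal_integral_stepLog_le (hc : ∀ y, LogClose (m.p θ₀ y x) (m.p θ y x) (c y))
    (hcm : Measurable c) :
    ENNReal.ofReal (∫ y, m.stepLog θ₀ θ y x ∂(m.kernel θ₀ x)) ≤
      ∫⁻ y, ENNReal.ofReal (c y ^ 2) ∂(m.kernel θ₀ x) +
        ∫⁻ y, ENNReal.ofReal (c y ^ 2) ∂(m.kernel θ x) := by
  -- Without integrability the Bochner integral is 0 by convention, and if a second moment of `c` is
  -- infinite so is the right side; only the finite case has content.
  by_cases hZ : Integrable (fun y => m.stepLog θ₀ θ y x) (m.kernel θ₀ x)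
  swap
  · rw [integral_undef hZ]; simp
  have hint : ∀ θ', Integrable (fun y => c y ^ 2) (m.kernel θ' x) ∨
      ∫⁻ y, ENNReal.ofReal (c y ^ 2) ∂(m.kernel θ' x) = ∞ := by
    intro θ'
    by_cases ht : ∫⁻ y, ENNReal.ofReal (c y ^ 2) ∂(m.kernel θ' x) = ∞
    · exact Or.inr ht
    · refine Or.inl ⟨(hcm.pow_const 2).aestronglyMeasurable, ?_⟩
      rw [hasFiniteIntegral_iff_ofReal (ae_of_all _ fun y => sq_nonneg _)]
      exact lt_top_iff_ne_top.2 ht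
  rcases hint θ₀ with h0 | h0
  swap
  · rw [h0]; simp
  rcases hint θ with h1 | h1
  swap
  · rw [h1]; simp
  have hn : ∀ θ', 0 ≤ ∫ y, c y ^ 2 ∂(m.kernel θ' x) := fun θ' =>
    integral_nonneg fun y => sq_nonneg _
  rw [← ofReal_integral_eq_lintegral_ofReal h0 (ae_of_all _ fun y => sq_nonneg _),
    ← ofReal_integral_eq_lintegral_ofReal h1 (ae_of_all _ fun y => sq_nonneg _),
    ← ENNReal.ofReal_add (hn _) (hn _)]
  apply ENNReal.ofReal_le_ofReal
  rw [m.integral_kernel, m.integral_kernel, m.integral_kernel]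
  rw [m.integrable_kernel_iff] at h0 h1 hZ
  have hp0 := m.integrable_p θ₀ x
  have hp1 := m.integrable_p θ x
  have key : ∫ y, m.p θ₀ y x * m.stepLog θ₀ θ y x ∂μ ≤
      ∫ y, (m.p θ₀ y x - m.p θ y x + (m.p θ₀ y x * c y ^ 2 + m.p θ y x * c y ^ 2)) ∂μ := by
    refine integral_mono hZ ((hp0.sub hp1).add (h0.add h1)) fun y => ?_
    have := (hc y).mul_log_le (m.nonneg_p _ _ _) (m.nonneg_p _ _ _)
    simp only [stepLog]
    linarith
  have e1 : ∫ y, (m.p θ₀ y x - m.p θ y x + (m.p θ₀ y x * c y ^ 2 + m.p θ y x * c y ^ 2)) ∂μ =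
      ∫ y, (m.p θ₀ y x - m.p θ y x) ∂μ +
        ∫ y, (m.p θ₀ y x * c y ^ 2 + m.p θ y x * c y ^ 2) ∂μ :=
    integral_add (hp0.sub hp1) (h0.add h1)
  rw [e1, integral_sub hp0 hp1, integral_add h0 h1, m.integral_p, m.integral_p] at key
  linarith

/-- The entropy inequality for one step of two chains with comparable densities. -/
theorem integral_log_le (hc : ∀ y, LogClose (m.p θ₀ y x) (m.p θ y x) (c y))
    (hci : Integrable c (m.kernel θ x)) {F : S → ℝ} {b : ℝ} (hF : Measurable F)
    (hF1 : ∀ y, 1 ≤ F y) (hFb : ∀ y, F y ≤ b) :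
    ∫ y, Real.log (F y) ∂(m.kernel θ x) ≤
      ∫ y, c y ∂(m.kernel θ x) + Real.log (∫ y, F y ∂(m.kernel θ₀ x)) := by
  have hFi : Integrable F (m.kernel θ₀ x) :=
    Integrable.of_bound hF.aestronglyMeasurable b (ae_of_all _ fun y => by
      rw [Real.norm_eq_abs, abs_of_nonneg (zero_le_one.trans (hF1 y))]; exact hFb y)
  have hLi : Integrable (fun y => Real.log (F y)) (m.kernel θ x) :=
    Integrable.of_bound hF.log.aestronglyMeasurable (Real.log b) (ae_of_all _ fun y => by
      rw [Real.norm_eq_abs, abs_of_nonneg (Real.log_nonneg (hF1 y))]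
      exact Real.log_le_log (zero_lt_one.trans_le (hF1 y)) (hFb y))
  have hA1 : 1 ≤ ∫ y, F y ∂(m.kernel θ₀ x) := by
    have := integral_mono (integrable_const (1 : ℝ)) hFi hF1
    simpa using this
  set A := ∫ y, F y ∂(m.kernel θ₀ x) with hA
  have hA0 : 0 < A := by linarith
  rw [m.integral_kernel, m.integral_kernel]
  rw [m.integral_kernel] at hA
  rw [m.integrable_kernel_iff] at hFi hLi hci
  have hp1 := m.integrable_p θ x
  have key : ∫ y, m.p θ y x * Real.log (F y) ∂μ ≤
      ∫ y, (m.p θ y x * c y + m.p θ y x * Real.log A + m.p θ₀ y x * F y / A - m.p θ y x) ∂μ := by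
    refine integral_mono hLi (((hci.add (hp1.mul_const _)).add (hFi.div_const _)).sub hp1)
      fun y => ?_
    exact (hc y).entropy_le (m.nonneg_p _ _ _) (m.nonneg_p _ _ _)
      (zero_lt_one.trans_le (hF1 y)) hA0
  have h2 : Integrable (fun y => m.p θ y x * c y + m.p θ y x * Real.log A) μ :=
    hci.add (hp1.mul_const _)
  have h3 : Integrable
      (fun y => m.p θ y x * c y + m.p θ y x * Real.log A + m.p θ₀ y x * F y / A) μ :=
    h2.add (hFi.div_const _)
  rw [integral_sub h3 hp1, integral_add h2 (hFi.div_const _),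
    integral_add hci (hp1.mul_const _), integral_div, integral_mul_const, m.integral_p,
    ← hA, div_self hA0.ne'] at key
  linarith

end TransitionModel

/-! ### Integration against invariant laws -/

section Auxiliary

variable {S : Type*} [MeasurableSpace S]

theorem ofReal_integral_le_lintegral {ν : Measure S} (f : S → ℝ) :
    ENNReal.ofReal (∫ x, f x ∂ν) ≤ ∫⁻ x, ENNReal.ofReal (f x) ∂ν := by
  by_cases hf : Integrable f ν
  · have h1 : ∫ x, f x ∂ν ≤ ∫ x, max (f x) 0 ∂ν :=
      integral_mono hf hf.pos_part fun x => le_max_left _ _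
    refine (ENNReal.ofReal_le_ofReal h1).trans ?_
    rw [ofReal_integral_eq_lintegral_ofReal hf.pos_part (ae_of_all _ fun x => le_max_right _ _)]
    refine lintegral_mono fun x => ?_
    simp
  · rw [integral_undef hf]; simp

theorem lintegral_lintegral_of_invariant {κ : Kernel S S} {ν : Measure S} (h : κ.Invariant ν)
    {f : S → ℝ≥0∞} (hf : Measurable f) : ∫⁻ x, ∫⁻ y, f y ∂(κ x) ∂ν = ∫⁻ x, f x ∂ν := by
  conv_rhs => rw [← h.def]
  rw [Measure.lintegral_bind κ.aemeasurable hf.aemeasurable]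

theorem integral_integral_of_invariant {κ : Kernel S S} {ν : Measure S} (h : κ.Invariant ν)
    {f : S → ℝ} (hf : Integrable f ν) : ∫ x, ∫ y, f y ∂(κ x) ∂ν = ∫ x, f x ∂ν := by
  have h1 : (κ ∘ₖ Kernel.const Unit ν) () = ν := by
    rw [← Measure.comp_eq_comp_const_apply]; exact h.def
  have h2 := Kernel.integral_comp (η := κ) (κ := Kernel.const Unit ν) (a := ()) (f := f)
    (by rwa [h1])
  rw [h1] at h2
  simpa using h2.symm

end Auxiliary

/-! ### Closeness of the stationary laws of comparable chains -/

namespace TransitionModel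

variable {Θ S : Type*} [MeasurableSpace Θ] [MeasurableSpace S] {μ : Measure S} [SigmaFinite μ]

/-- The chain with parameter `θ`, with invariant law `ν`, is comparable with the chain with
parameter `θ₀`: the log-densities differ by at most `s * M`, where `M ≥ 1` has a moment of order
`p` under the stationary chain with parameter `θ`. -/
structure Comparable (m : TransitionModel Θ S μ) (θ₀ θ : Θ) (ν : Measure S)
    (M : S → S → ℝ) (p B s : ℝ) : Prop where
  invariant : (m.kernel θ).Invariant ν
  measurable_M : Measurable fun z : S × S => M z.1 z.2
  one_le_M : ∀ y x, 1 ≤ M y x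
  two_le : 2 ≤ p
  nonneg_B : 0 ≤ B
  nonneg_s : 0 ≤ s
  logClose : ∀ y x, LogClose (m.p θ₀ y x) (m.p θ y x) (s * M y x)
  moment : ∫⁻ x, ∫⁻ y, ENNReal.ofReal (M y x ^ p) ∂(m.kernel θ x) ∂ν ≤ ENNReal.ofReal B

namespace Comparable

variable {m : TransitionModel Θ S μ} {θ₀ θ : Θ} {ν : Measure S}
  {M : S → S → ℝ} {p B s : ℝ}

theorem measurable_M_left (h : m.Comparable θ₀ θ ν M p B s) (x : S) :
    Measurable fun y => M y x :=
  h.measurable_M.comp (by fun_prop : Measurable fun y : S => (y, x))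

theorem M_pos (h : m.Comparable θ₀ θ ν M p B s) (y x : S) : 0 < M y x :=
  zero_lt_one.trans_le (h.one_le_M y x)

theorem M_le (h : m.Comparable θ₀ θ ν M p B s) (y x : S) : M y x ≤ M y x ^ p :=
  Real.self_le_rpow_of_one_le (h.one_le_M y x) (by linarith [h.two_le])

theorem M_sq_le (h : m.Comparable θ₀ θ ν M p B s) (y x : S) : M y x ^ 2 ≤ M y x ^ p := by
  rw [← Real.rpow_two]
  exact Real.rpow_le_rpow_of_exponent_le (h.one_le_M y x) h.two_le

theorem abs_stepLog_le (h : m.Comparable θ₀ θ ν M p B s) (y x : S) :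
    |m.stepLog θ₀ θ y x| ≤ s * M y x := (h.logClose y x).2

theorem lintegral_sM_le (h : m.Comparable θ₀ θ ν M p B s) :
    ∫⁻ x, ∫⁻ y, ENNReal.ofReal (s * M y x) ∂(m.kernel θ x) ∂ν ≤ ENNReal.ofReal (s * B) := by
  calc ∫⁻ x, ∫⁻ y, ENNReal.ofReal (s * M y x) ∂(m.kernel θ x) ∂ν
      ≤ ∫⁻ x, ∫⁻ y, ENNReal.ofReal s * ENNReal.ofReal (M y x ^ p) ∂(m.kernel θ x) ∂ν := by
        refine lintegral_mono fun x => lintegral_mono fun y => ?_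
        rw [ENNReal.ofReal_mul h.nonneg_s]
        gcongr
        exact h.M_le y x
    _ = ENNReal.ofReal s *
          ∫⁻ x, ∫⁻ y, ENNReal.ofReal (M y x ^ p) ∂(m.kernel θ x) ∂ν := by
        simp_rw [lintegral_const_mul' _ _ ENNReal.ofReal_ne_top]
    _ ≤ _ := by
        rw [ENNReal.ofReal_mul h.nonneg_s]
        gcongr
        exact h.moment

/-- The stationary law of the comparable chain puts little mass where `V` is large. -/
theorem lintegral_drift_le [IsProbabilityMeasure ν] (h : m.Comparable θ₀ θ ν M p B s) (hs : 0 < s) {U V : S → ℝ} {v : ℝ}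
    (hUm : Measurable U) (hVm : Measurable V) (hU0 : ∀ x, 0 ≤ U x) (hV0 : ∀ x, 0 ≤ V x)
    (hv : 0 ≤ v) (hUi : ∀ x, Integrable U (m.kernel θ₀ x))
    (hdrift : ∀ x, ∫ y, U y ∂(m.kernel θ₀ x) ≤ U x - V x / 2 + v) :
    ∫⁻ x, ENNReal.ofReal (V x / (1 + s * U x)) ∂ν ≤ ENNReal.ofReal (2 * (B + v)) := by
  have key : ∀ N : ℕ, ∫⁻ x, {x | U x ≤ N}.indicator
      (fun x => ENNReal.ofReal (V x / (1 + s * U x))) x ∂ν ≤ ENNReal.ofReal (2 * (B + v)) := by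
    intro N
    -- Truncating `U` makes `log F` bounded, so that invariance of `ν` can be used although nothing
    -- is known about `U` under `ν`.
    set F : S → ℝ := fun x => 1 + s * min (U x) N with hF
    have hmin0 : ∀ x, 0 ≤ min (U x) (N : ℝ) := fun x => le_min (hU0 x) (Nat.cast_nonneg _)
    have hFm : Measurable F := ((hUm.min measurable_const).const_mul s).const_add 1
    have hF1 : ∀ x, 1 ≤ F x := fun x => by
      have := mul_nonneg hs.le (hmin0 x)
      simp only [hF]; linarith
    have hF0 : ∀ x, 0 < F x := fun x => zero_lt_one.trans_le (hF1 x)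
    have hFb : ∀ x, F x ≤ 1 + s * N := fun x => by
      simp only [hF]; gcongr; exact min_le_right _ _
    have hbd : ∀ {P : Measure S} [IsProbabilityMeasure P] {f : S → ℝ}, Measurable f →
        (∀ x, 0 ≤ f x) → (∀ x, f x ≤ Real.log (1 + s * N)) → Integrable f P := by
      intro P _ f hf hf0 hfb
      refine Integrable.of_bound hf.aestronglyMeasurable (Real.log (1 + s * N))
        (ae_of_all _ fun y => ?_)
      rw [Real.norm_eq_abs, abs_of_nonneg (hf0 y)]
      exact hfb y
    have hlogF0 : ∀ x, 0 ≤ Real.log (F x) := fun x => Real.log_nonneg (hF1 x)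
    have hlogFb : ∀ x, Real.log (F x) ≤ Real.log (1 + s * N) := fun x =>
      Real.log_le_log (hF0 x) (hFb x)
    have hFi : ∀ x, Integrable F (m.kernel θ₀ x) := fun x =>
      Integrable.of_bound hFm.aestronglyMeasurable (1 + s * N) (ae_of_all _ fun y => by
        rw [Real.norm_eq_abs, abs_of_nonneg (hF0 y).le]; exact hFb y)
    set A : S → ℝ := fun x => ∫ y, F y ∂(m.kernel θ₀ x) with hA
    have hAm : Measurable A :=
      (hFm.stronglyMeasurable.integral_kernel (κ := m.kernel θ₀)).measurable
    have hA1 : ∀ x, 1 ≤ A x := fun x => by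
      have := integral_mono (integrable_const (1 : ℝ)) (hFi x) hF1
      simpa using this
    have hAb : ∀ x, A x ≤ 1 + s * N := fun x => by
      have := integral_mono (hFi x) (integrable_const (1 + s * (N : ℝ))) hFb
      simpa using this
    have hlogA0 : ∀ x, 0 ≤ Real.log (A x) := fun x => Real.log_nonneg (hA1 x)
    have hlogAb : ∀ x, Real.log (A x) ≤ Real.log (1 + s * N) := fun x =>
      Real.log_le_log (zero_lt_one.trans_le (hA1 x)) (hAb x)
    have hGm : Measurable fun x => ∫ y, Real.log (F y) ∂(m.kernel θ x) :=
      (hFm.log.stronglyMeasurable.integral_kernel (κ := m.kernel θ)).measurable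
    have hlogFi : ∀ {P : Measure S} [IsProbabilityMeasure P],
        Integrable (fun x => Real.log (F x)) P := hbd hFm.log hlogF0 hlogFb
    have hGi : Integrable (fun x => ∫ y, Real.log (F y) ∂(m.kernel θ x)) ν := by
      refine hbd hGm (fun x => integral_nonneg hlogF0) fun x => ?_
      have := integral_mono (hlogFi (P := m.kernel θ x))
        (integrable_const (Real.log (1 + s * (N : ℝ)))) hlogFb
      simpa using this
    have hlogAi : Integrable (fun x => Real.log (A x)) ν := hbd hAm.log hlogA0 hlogAb
    have hstep : ∀ x, ENNReal.ofReal (∫ y, Real.log (F y) ∂(m.kernel θ x) - Real.log (A x)) ≤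
        ∫⁻ y, ENNReal.ofReal (s * M y x) ∂(m.kernel θ x) := by
      intro x
      have hcm := (h.measurable_M_left x).const_mul s
      have hc0 : ∀ y, 0 ≤ s * M y x := fun y => mul_nonneg hs.le (h.M_pos y x).le
      by_cases ht : ∫⁻ y, ENNReal.ofReal (s * M y x) ∂(m.kernel θ x) = ∞
      · rw [ht]; exact le_top
      have hi : Integrable (fun y => s * M y x) (m.kernel θ x) := by
        refine ⟨hcm.aestronglyMeasurable, ?_⟩
        rw [hasFiniteIntegral_iff_ofReal (ae_of_all _ hc0)]
        exact lt_top_iff_ne_top.2 ht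
      rw [← ofReal_integral_eq_lintegral_ofReal hi (ae_of_all _ hc0)]
      apply ENNReal.ofReal_le_ofReal
      have := integral_log_le (fun y => h.logClose y x) hi hFm hF1 hFb
      simp only [hA]
      linarith
    -- Invariance replaces `log F` by its one-step mean under `θ`, and the entropy inequality
    -- compares this with `log A`, where `A` is the mean of `F` under `θ₀`.
    have hsB : ∫ x, (Real.log (F x) - Real.log (A x)) ∂ν ≤ s * B := by
      have h1 : ∫ x, (Real.log (F x) - Real.log (A x)) ∂ν =
          ∫ x, (∫ y, Real.log (F y) ∂(m.kernel θ x) - Real.log (A x)) ∂ν := by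
        rw [integral_sub hlogFi hlogAi, integral_sub hGi hlogAi,
          integral_integral_of_invariant h.invariant hlogFi]
      rw [h1, ← ENNReal.ofReal_le_ofReal_iff (mul_nonneg hs.le h.nonneg_B)]
      exact (ofReal_integral_le_lintegral _).trans ((lintegral_mono hstep).trans h.lintegral_sM_le)
    -- Here `log F - log A ≥ 1 - A / F`. On `{U ≤ N}` the drift gives `F - A ≥ s (V / 2 - v)`; off
    -- this set `F` attains its maximum, so `A ≤ F`.
    have hpt : ∀ x, {x | U x ≤ N}.indicator (fun x => V x / (1 + s * U x)) x ≤
        2 / s * (Real.log (F x) - Real.log (A x)) + 2 * v := by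
      intro x
      have hAx : A x = 1 + s * ∫ y, min (U y) (N : ℝ) ∂(m.kernel θ₀ x) := by
        have hi : Integrable (fun y => min (U y) (N : ℝ)) (m.kernel θ₀ x) :=
          (hUi x).mono' (hUm.min measurable_const).aestronglyMeasurable (ae_of_all _ fun y => by
            rw [Real.norm_eq_abs, abs_of_nonneg (hmin0 y)]; exact min_le_left _ _)
        simp only [hA, hF]
        rw [integral_add (integrable_const _) (hi.const_mul s), integral_const_mul]
        simp
      have hA0 : 0 < A x := zero_lt_one.trans_le (hA1 x)
      have hlog : 1 - A x / F x ≤ Real.log (F x) - Real.log (A x) := by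
        have := Real.log_le_sub_one_of_pos (div_pos hA0 (hF0 x))
        rw [Real.log_div hA0.ne' (hF0 x).ne'] at this
        linarith
      have hgoal : ∀ w, w ≤ 2 / s * (1 - A x / F x) + 2 * v →
          w ≤ 2 / s * (Real.log (F x) - Real.log (A x)) + 2 * v := fun w hw => by
        refine hw.trans ?_
        gcongr
      apply hgoal
      by_cases hx : U x ≤ N
      · rw [Set.indicator_of_mem (by exact hx)]
        have hFx : F x = 1 + s * U x := by simp only [hF]; rw [min_eq_left hx]
        have hAle : A x ≤ F x - s * (V x / 2) + s * v := by
          have h2 : ∫ y, min (U y) (N : ℝ) ∂(m.kernel θ₀ x) ≤ ∫ y, U y ∂(m.kernel θ₀ x) :=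
            integral_mono_of_nonneg (ae_of_all _ hmin0) (hUi x)
              (ae_of_all _ fun y => min_le_left _ _)
          rw [hAx, hFx]
          nlinarith [hdrift x]
        rw [← hFx]
        have h3 : V x / F x ≤ 2 / s * (1 - A x / F x) + 2 * v / F x := by
          have hF0x := hF0 x
          have : 2 / s * (1 - A x / F x) + 2 * v / F x - V x / F x =
              (2 / s) * (F x - A x + s * v - s * (V x / 2)) / F x := by
            field_simp
          have h4 : 0 ≤ (2 / s) * (F x - A x + s * v - s * (V x / 2)) / F x := by
            apply div_nonneg _ hF0x.le
            apply mul_nonneg (by positivity)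
            linarith
          linarith
        have h5 : 2 * v / F x ≤ 2 * v := div_le_self (by positivity) (hF1 x)
        linarith
      · rw [Set.indicator_of_notMem (by exact hx)]
        have hFx : F x = 1 + s * N := by simp only [hF]; rw [min_eq_right (not_le.1 hx).le]
        have h3 : A x / F x ≤ 1 := by
          rw [div_le_one (hF0 x), hFx]
          exact hAb x
        have : 0 ≤ 2 / s * (1 - A x / F x) := mul_nonneg (by positivity) (by linarith)
        linarith
    have hDi : Integrable (fun x => 2 / s * (Real.log (F x) - Real.log (A x))) ν :=
      (hlogFi.sub hlogAi).const_mul _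
    have hLi : Integrable
        (fun x => 2 / s * (Real.log (F x) - Real.log (A x)) + 2 * v) ν :=
      hDi.add (integrable_const _)
    have hind0 : ∀ x, 0 ≤ {x | U x ≤ N}.indicator (fun x => V x / (1 + s * U x)) x := fun x =>
      Set.indicator_nonneg (fun x _ => by
        have := hU0 x
        have := hV0 x
        positivity) x
    calc ∫⁻ x, {x | U x ≤ N}.indicator (fun x => ENNReal.ofReal (V x / (1 + s * U x))) x ∂ν
        = ∫⁻ x, ENNReal.ofReal ({x | U x ≤ N}.indicator (fun x => V x / (1 + s * U x)) x) ∂ν := by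
          refine lintegral_congr fun x => ?_
          by_cases hx : U x ≤ N
          · rw [Set.indicator_of_mem (by exact hx), Set.indicator_of_mem (by exact hx)]
          · rw [Set.indicator_of_notMem (by exact hx), Set.indicator_of_notMem (by exact hx)]
            simp
      _ ≤ ∫⁻ x, ENNReal.ofReal (2 / s * (Real.log (F x) - Real.log (A x)) + 2 * v) ∂ν :=
          lintegral_mono fun x => ENNReal.ofReal_le_ofReal (hpt x)
      _ = ENNReal.ofReal (∫ x, (2 / s * (Real.log (F x) - Real.log (A x)) + 2 * v) ∂ν) :=
          (ofReal_integral_eq_lintegral_ofReal hLi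
            (ae_of_all _ fun x => (hind0 x).trans (hpt x))).symm
      _ ≤ _ := by
          apply ENNReal.ofReal_le_ofReal
          rw [integral_add hDi (integrable_const _),
            integral_const_mul, integral_const]
          have h6 : 2 / s * ∫ x, (Real.log (F x) - Real.log (A x)) ∂ν ≤ 2 / s * (s * B) := by
            gcongr
          have h7 : 2 / s * (s * B) = 2 * B := by field_simp
          simp only [probReal_univ, one_smul]
          linarith
  have hsup : ∀ x, ENNReal.ofReal (V x / (1 + s * U x)) = ⨆ N : ℕ, {x | U x ≤ N}.indicator
      (fun x => ENNReal.ofReal (V x / (1 + s * U x))) x := by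
    intro x
    apply le_antisymm
    · obtain ⟨N, hN⟩ := exists_nat_ge (U x)
      refine le_trans ?_ (le_iSup _ N)
      rw [Set.indicator_of_mem (by exact hN)]
    · exact iSup_le fun N => Set.indicator_le_self _ _ _
  rw [lintegral_congr hsup, lintegral_iSup]
  · exact iSup_le key
  · intro N
    exact (hVm.div ((hUm.const_mul s).const_add 1)).ennreal_ofReal.indicator
      (measurableSet_le hUm measurable_const)
  · intro N N' hN x
    refine Set.indicator_le_indicator_of_subset (fun y hy => ?_) (fun _ => zero_le) x
    have : (N : ℝ) ≤ N' := by exact_mod_cast hN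
    exact le_trans (show U y ≤ N from hy) this

/-- By invariance a step of the `θ`-chain can be inserted for free; exchanging it for a step of the
`θ₀`-chain costs `s * B`. The costs add up because the remaining `θ₀`-steps keep the test function
below 1. -/
theorem lintegral_le_pow_add [IsProbabilityMeasure ν] (h : m.Comparable θ₀ θ ν M p B s) {f : S → ℝ≥0∞}
    (hf : Measurable f) (hf1 : ∀ y, f y ≤ 1) (j : ℕ) :
    ∫⁻ x, f x ∂ν ≤ ∫⁻ x, ∫⁻ y, f y ∂((m.kernel θ₀ ^ j) x) ∂ν + j * ENNReal.ofReal (s * B) := by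
  induction j with
  | zero =>
    simp_rw [lintegral_pow_zero _ _ hf]
    simp
  | succ j ih =>
    refine ih.trans ?_
    have := isMarkovKernel_pow (m.kernel θ₀) j
    have hgm : Measurable fun x => ∫⁻ y, f y ∂((m.kernel θ₀ ^ j) x) :=
      hf.lintegral_kernel (κ := m.kernel θ₀ ^ j)
    have hg1 : ∀ x, ∫⁻ y, f y ∂((m.kernel θ₀ ^ j) x) ≤ 1 := fun x => by
      have := lintegral_mono (μ := (m.kernel θ₀ ^ j) x) hf1
      simpa using this
    simp_rw [lintegral_pow_succ _ j _ hf]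
    have hcm : Measurable fun x => ∫⁻ y, ENNReal.ofReal (s * M y x) ∂(m.kernel θ x) :=
      Measurable.lintegral_kernel_prod_right (f := fun x y => ENNReal.ofReal (s * M y x))
        (κ := m.kernel θ) ((h.measurable_M.comp measurable_swap).const_mul s).ennreal_ofReal
    calc ∫⁻ x, ∫⁻ y, f y ∂((m.kernel θ₀ ^ j) x) ∂ν + j * ENNReal.ofReal (s * B)
        = ∫⁻ x, ∫⁻ z, ∫⁻ y, f y ∂((m.kernel θ₀ ^ j) z) ∂(m.kernel θ x) ∂ν +
            j * ENNReal.ofReal (s * B) := by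
          rw [lintegral_lintegral_of_invariant h.invariant hgm]
      _ ≤ ∫⁻ x, (∫⁻ z, ∫⁻ y, f y ∂((m.kernel θ₀ ^ j) z) ∂(m.kernel θ₀ x) +
            ∫⁻ y, ENNReal.ofReal (s * M y x) ∂(m.kernel θ x)) ∂ν + j * ENNReal.ofReal (s * B) := by
          gcongr with x
          exact lintegral_kernel_le_add (fun y => h.logClose y x)
            ((h.measurable_M_left x).const_mul s) hgm hg1
      _ ≤ ∫⁻ x, ∫⁻ z, ∫⁻ y, f y ∂((m.kernel θ₀ ^ j) z) ∂(m.kernel θ₀ x) ∂ν +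
            ENNReal.ofReal (s * B) + j * ENNReal.ofReal (s * B) := by
          rw [lintegral_add_right _ hcm]
          gcongr
          exact h.lintegral_sM_le
      _ = _ := by push_cast; ring

variable {Q : Measure S} [IsProbabilityMeasure Q] {V : S → ℝ} {r R : ℝ}

/-- The stationary laws of comparable chains are close. -/
theorem exists_measure_le (hG : GeomErg (m.kernel θ₀) Q V r R) (p B : ℝ) :
    ∃ C : ℝ, 0 ≤ C ∧ ∀ (θ : Θ) (ν : Measure S) (_ : IsProbabilityMeasure ν) (s : ℝ),
      0 < s → m.Comparable θ₀ θ ν M p B s → ∀ (j : ℕ), (r ^ j)⁻¹ ≤ s →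
        ∀ E, MeasurableSet E → ν E ≤ Q E + ENNReal.ofReal (s * (C + j * B)) := by
  obtain ⟨U, c, hUm, hc, hU0, hUV, hUi, hdrift⟩ := hG.exists_drift
  have hv := hG.one_le_integral
  have hR := hG.R_pos
  set v := ∫ y, V y ∂Q with hvdef
  refine ⟨(1 + R) * c * (2 * (|B| + v)), by positivity, ?_⟩
  intro θ ν _ s hs h j hj E hE
  have hB := h.nonneg_B
  rw [abs_of_nonneg hB]
  have h1 := h.lintegral_drift_le hs hUm hG.measurable_V hU0 (fun x => (hG.V_pos x).le)
    (by linarith) hUi hdrift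
  have := isMarkovKernel_pow (m.kernel θ₀) j
  have h2 : ∀ x, (m.kernel θ₀ ^ j) x E ≤ Q E +
      ENNReal.ofReal (s * ((1 + R) * c)) * ENNReal.ofReal (V x / (1 + s * U x)) := by
    intro x
    have hV := hG.V_pos x
    -- The ergodic error is at most `min 1 (R s V)`. Together with `U ≤ c V` this is dominated by a
    -- multiple of `s V / (1 + s U)`, the quantity whose `ν`-integral is under control.
    have hmono : ∀ w, w ≤ 1 → w ≤ R * V x * (r ^ j)⁻¹ →
        w ≤ s * ((1 + R) * c) * (V x / (1 + s * U x)) := by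
      intro w hw1 hw2
      have h3 : w ≤ R * V x * s := hw2.trans (by gcongr)
      have h4 : 0 < 1 + s * U x := by have := hU0 x; positivity
      rw [mul_div_assoc', le_div_iff₀ h4]
      rcases le_or_gt w 0 with hw | hw
      · have h5 : 0 ≤ s * ((1 + R) * c) * V x := by positivity
        nlinarith
      · have h5 : w * (s * U x) ≤ 1 * (s * (c * V x)) := by
          have := hUV x
          have := hU0 x
          gcongr
        have h6 : R * V x * s ≤ c * (R * V x * s) := le_mul_of_one_le_left (by positivity) hc
        nlinarith
    rw [← ENNReal.ofReal_mul (by positivity)]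
    rw [← ENNReal.ofReal_toReal (measure_ne_top ((m.kernel θ₀ ^ j) x) E),
      ← ENNReal.ofReal_toReal (measure_ne_top Q E)]
    have h0 : 0 ≤ s * ((1 + R) * c) * (V x / (1 + s * U x)) := by
      have := hU0 x
      positivity
    rw [← ENNReal.ofReal_add ENNReal.toReal_nonneg h0]
    apply ENNReal.ofReal_le_ofReal
    have h3 := hG.abs_sub_le x j (E.indicator 1) (measurable_one.indicator hE) (fun y => by
      refine le_trans ?_ (hG.one_le_V y)
      by_cases hy : y ∈ E <;> simp [hy])
      ((integrable_const (1 : ℝ)).indicator hE)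
    rw [integral_indicator_one hE, integral_indicator_one hE] at h3
    have h4 : ((m.kernel θ₀ ^ j) x).real E ≤ 1 := measureReal_le_one
    have h5 : 0 ≤ Q.real E := measureReal_nonneg
    have h6 := hmono (((m.kernel θ₀ ^ j) x).real E - Q.real E) (by linarith)
      ((le_abs_self _).trans h3)
    simp only [measureReal_def] at h6
    linarith
  have h3 := h.lintegral_le_pow_add (f := E.indicator 1) (measurable_one.indicator hE)
    (fun y => Set.indicator_le_self' (fun _ _ => zero_le) _) j
  simp_rw [lintegral_indicator_one hE] at h3
  calc ν E ≤ ∫⁻ x, (m.kernel θ₀ ^ j) x E ∂ν + j * ENNReal.ofReal (s * B) := h3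
    _ ≤ ∫⁻ x, (Q E + ENNReal.ofReal (s * ((1 + R) * c)) *
          ENNReal.ofReal (V x / (1 + s * U x))) ∂ν + j * ENNReal.ofReal (s * B) := by
        gcongr with x
        exact h2 x
    _ ≤ Q E + ENNReal.ofReal (s * ((1 + R) * c)) * ENNReal.ofReal (2 * (B + v)) +
          j * ENNReal.ofReal (s * B) := by
        rw [lintegral_add_left measurable_const, lintegral_const_mul' _ _ ENNReal.ofReal_ne_top]
        simp only [lintegral_const, measure_univ, mul_one]
        gcongr
    _ = _ := by
        rw [← ENNReal.ofReal_mul (by positivity), ← ENNReal.ofReal_natCast, 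
          ← ENNReal.ofReal_mul (by positivity), add_assoc, ← ENNReal.ofReal_add
            (by positivity) (by positivity)]
        congr 2
        ring

end Comparable

end TransitionModel

/-- Truncation at level `t`, which is left free so that each use can balance the two terms. -/
theorem rpow_le_add_mul_rpow {x t e p : ℝ} (hx : 0 ≤ x) (ht : 0 < t) (he : 0 ≤ e) (hep : e ≤ p) :
    x ^ e ≤ t ^ e + t ^ (e - p) * x ^ p := by
  rcases le_or_gt x t with h | h
  · have h1 := Real.rpow_le_rpow hx h he
    have h2 : 0 ≤ t ^ (e - p) * x ^ p := by positivity
    linarith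
  · have hx0 : 0 < x := ht.trans h
    have h1 : x ^ (e - p) ≤ t ^ (e - p) := Real.rpow_le_rpow_of_nonpos ht h.le (by linarith)
    have h2 : x ^ e = x ^ (e - p) * x ^ p := by rw [← Real.rpow_add hx0]; ring_nf
    have h3 : x ^ (e - p) * x ^ p ≤ t ^ (e - p) * x ^ p := by gcongr
    have h4 : 0 ≤ t ^ e := by positivity
    linarith

/-! ### The stationary mean log-ratio is `O(s^(3/2))` -/

section Density

variable {S : Type*} [MeasurableSpace S] {μ : Measure S} {q q' : S → ℝ}

theorem IsProbDensity.isProbabilityMeasure (h : IsProbDensity μ q) :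
    IsProbabilityMeasure (densityLaw μ q) :=
  ⟨by rw [densityLaw, withDensity_apply _ .univ, setLIntegral_univ, h.lintegral_eq_one]⟩

theorem two_mul_densityLaw_le (hq : Measurable q) (hq' : Measurable q') :
    2 * densityLaw μ q' {x | 2 * q' x < q x} ≤ densityLaw μ q {x | 2 * q' x < q x} := by
  have hA : MeasurableSet {x | 2 * q' x < q x} := measurableSet_lt (hq'.const_mul 2) hq
  rw [densityLaw, densityLaw, withDensity_apply _ hA, withDensity_apply _ hA,
    ← lintegral_const_mul _ hq'.ennreal_ofReal]
  refine setLIntegral_mono hq.ennreal_ofReal fun x hx => ?_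
  rw [← ENNReal.ofReal_ofNat 2, ← ENNReal.ofReal_mul (by norm_num)]
  exact ENNReal.ofReal_le_ofReal (le_of_lt hx)

theorem setLIntegral_densityLaw_le (hq : Measurable q) (hq' : Measurable q') {f : S → ℝ≥0∞}
    (hf : Measurable f) :
    ∫⁻ x in {x | 2 * q' x < q x}ᶜ, f x ∂(densityLaw μ q) ≤ 2 * ∫⁻ x, f x ∂(densityLaw μ q') := by
  have hA : MeasurableSet {x | 2 * q' x < q x} := measurableSet_lt (hq'.const_mul 2) hq
  rw [densityLaw, densityLaw, restrict_withDensity hA.compl,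
    lintegral_withDensity_eq_lintegral_mul _ hq.ennreal_ofReal hf,
    lintegral_withDensity_eq_lintegral_mul _ hq'.ennreal_ofReal hf,
    ← lintegral_const_mul _ (hq'.ennreal_ofReal.mul hf)]
  refine le_trans ?_ (setLIntegral_le_lintegral ({x | 2 * q' x < q x}ᶜ) _)
  refine setLIntegral_mono ((hq'.ennreal_ofReal.mul hf).const_mul 2) fun x hx => ?_
  have hx' : q x ≤ 2 * q' x := not_lt.1 hx
  simp only [Pi.mul_apply, ← mul_assoc]
  gcongr
  rw [← ENNReal.ofReal_ofNat 2, ← ENNReal.ofReal_mul (by norm_num)]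
  exact ENNReal.ofReal_le_ofReal hx'

end Density

namespace TransitionModel

variable {Θ S : Type*} [MeasurableSpace Θ] [MeasurableSpace S] {μ : Measure S} [SigmaFinite μ]

namespace Comparable

variable {m : TransitionModel Θ S μ} {θ₀ θ : Θ} {M : S → S → ℝ} {p B s : ℝ}

/-- The first-order bound `s * M`, with `M` split at level `a`: on a small set of states, the part
`M ≤ a` gains from the smallness of the set and the tail gains from `a ^ (1 - p)`. -/
theorem ofReal_integral_stepLog_le_mul {ν : Measure S} (h : m.Comparable θ₀ θ ν M p B s) {C₁ : ℝ}
    (hC₁ : 0 ≤ C₁) {V : S → ℝ}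
    (hMV : ∀ x, ∫⁻ y, ENNReal.ofReal (M y x ^ p) ∂(m.kernel θ₀ x) ≤ ENNReal.ofReal (C₁ * V x))
    {a : ℝ} (ha : 0 < a) (x : S) :
    ENNReal.ofReal (∫ y, m.stepLog θ₀ θ y x ∂(m.kernel θ₀ x)) ≤
      ENNReal.ofReal (s * a) + ENNReal.ofReal (s * a ^ (1 - p) * C₁) * ENNReal.ofReal (V x) := by
  have hp := h.two_le
  have hs := h.nonneg_s
  refine (ofReal_integral_le_lintegral _).trans ?_
  have h1 : ∀ y, ENNReal.ofReal (m.stepLog θ₀ θ y x) ≤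
      ENNReal.ofReal (s * a) + ENNReal.ofReal (s * a ^ (1 - p)) * ENNReal.ofReal (M y x ^ p) := by
    intro y
    have h2 := rpow_le_add_mul_rpow (h.M_pos y x).le ha zero_le_one (by linarith : 1 ≤ p)
    rw [Real.rpow_one, Real.rpow_one] at h2
    have h3 := (le_abs_self _).trans (h.abs_stepLog_le y x)
    have h4 : 0 ≤ M y x ^ p := Real.rpow_nonneg (h.M_pos y x).le _
    rw [← ENNReal.ofReal_mul (by positivity), ← ENNReal.ofReal_add (by positivity) (by positivity)]
    apply ENNReal.ofReal_le_ofReal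
    calc m.stepLog θ₀ θ y x ≤ s * M y x := h3
      _ ≤ s * (a + a ^ (1 - p) * M y x ^ p) := by gcongr
      _ = _ := by ring
  refine (lintegral_mono h1).trans ?_
  rw [lintegral_add_left measurable_const, lintegral_const_mul' _ _ ENNReal.ofReal_ne_top,
    lintegral_const, measure_univ, mul_one, ENNReal.ofReal_mul (p := s * a ^ (1 - p)) (by positivity),
    mul_assoc]
  gcongr
  rw [← ENNReal.ofReal_mul hC₁]
  exact hMV x

variable {q q' : S → ℝ} {V : S → ℝ} {r R : ℝ}

theorem integral_stepLog_le_mul (h : m.Comparable θ₀ θ (densityLaw μ q') M p B s)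
    (hq : IsProbDensity μ q)
    (hG : GeomErg (m.kernel θ₀) (densityLaw μ q) V r R) {C₁ : ℝ} (hC₁ : 0 ≤ C₁)
    (hMV : ∀ x, ∫⁻ y, ENNReal.ofReal (M y x ^ p) ∂(m.kernel θ₀ x) ≤ ENNReal.ofReal (C₁ * V x)) :
    ∫ x, ∫ y, m.stepLog θ₀ θ y x ∂(m.kernel θ₀ x) ∂(densityLaw μ q) ≤
      s * (1 + C₁ * ∫ x, V x ∂(densityLaw μ q)) := by
  have := hq.isProbabilityMeasure
  have hs := h.nonneg_s
  have hv := hG.one_le_integral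
  have hV0 : ∀ x, 0 ≤ V x := fun x => (hG.V_pos x).le
  have h0 : 0 ≤ s * (1 + C₁ * ∫ x, V x ∂(densityLaw μ q)) := by positivity
  rw [← ENNReal.ofReal_le_ofReal_iff h0]
  refine (ofReal_integral_le_lintegral _).trans ?_
  refine (lintegral_mono fun x => h.ofReal_integral_stepLog_le_mul hC₁ hMV zero_lt_one x).trans ?_
  rw [lintegral_add_left measurable_const, lintegral_const_mul' _ _ ENNReal.ofReal_ne_top,
    lintegral_const, measure_univ, mul_one,
    ← ofReal_integral_eq_lintegral_ofReal hG.integrable_V (ae_of_all _ hV0),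
    ← ENNReal.ofReal_mul (by positivity), ← ENNReal.ofReal_add (by positivity) (by positivity)]
  apply ENNReal.ofReal_le_ofReal
  simp only [Real.one_rpow]
  linarith

theorem integral_stepLog_le (h : m.Comparable θ₀ θ (densityLaw μ q') M p B s)
    (hq : IsProbDensity μ q) (hq' : IsProbDensity μ q')
    (hG : GeomErg (m.kernel θ₀) (densityLaw μ q) V r R) {C₁ : ℝ} (hC₁ : 0 ≤ C₁)
    (hMV : ∀ x, ∫⁻ y, ENNReal.ofReal (M y x ^ p) ∂(m.kernel θ₀ x) ≤ ENNReal.ofReal (C₁ * V x))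
    {X : ℝ} (hX : 0 ≤ X)
    (hνQ : ∀ E, MeasurableSet E → densityLaw μ q' E ≤ densityLaw μ q E + ENNReal.ofReal X)
    {a : ℝ} (ha : 0 < a) :
    ∫ x, ∫ y, m.stepLog θ₀ θ y x ∂(m.kernel θ₀ x) ∂(densityLaw μ q) ≤
      s ^ 2 * (C₁ * ∫ x, V x ∂(densityLaw μ q) + 2 * B) +
        (s * a * (2 * X) + s * a ^ (1 - p) * C₁ * ∫ x, V x ∂(densityLaw μ q)) := by
  have := hq.isProbabilityMeasure
  have := hq'.isProbabilityMeasure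
  have hs := h.nonneg_s
  have hB := h.nonneg_B
  have hv := hG.one_le_integral
  have hV0 : ∀ x, 0 ≤ V x := fun x => (hG.V_pos x).le
  set Q := densityLaw μ q with hQ
  set ν := densityLaw μ q' with hν
  set v := ∫ x, V x ∂Q with hvdef
  have hVv : ∫⁻ x, ENNReal.ofReal (V x) ∂Q = ENNReal.ofReal v :=
    (ofReal_integral_eq_lintegral_ofReal hG.integrable_V (ae_of_all _ hV0)).symm
  set A : Set S := {x | 2 * q' x < q x} with hA
  have hAm : MeasurableSet A := measurableSet_lt (hq'.measurable.const_mul 2) hq.measurable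
  -- On `A` the law `ν` has at most half the mass of `Q`, so `Q A / 2 ≤ Q A - ν A = ν Aᶜ - Q Aᶜ ≤
  -- X`.
  have hQA : Q A ≤ ENNReal.ofReal (2 * X) := by
    have h1 := hνQ Aᶜ hAm.compl
    have h2 : 2 * ν A ≤ Q A := two_mul_densityLaw_le hq.measurable hq'.measurable
    rw [← ENNReal.ofReal_toReal (measure_ne_top ν Aᶜ), ← ENNReal.ofReal_toReal (measure_ne_top Q Aᶜ),
      ← ENNReal.ofReal_add ENNReal.toReal_nonneg hX,
      ENNReal.ofReal_le_ofReal_iff (by positivity)] at h1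
    rw [← ENNReal.ofReal_toReal (measure_ne_top ν A), ← ENNReal.ofReal_toReal (measure_ne_top Q A),
      ← ENNReal.ofReal_ofNat 2, ← ENNReal.ofReal_mul (by norm_num),
      ENNReal.ofReal_le_ofReal_iff (by positivity)] at h2
    have h3 : ν.real Aᶜ = 1 - ν.real A := probReal_compl_eq_one_sub hAm
    have h4 : Q.real Aᶜ = 1 - Q.real A := probReal_compl_eq_one_sub hAm
    rw [← ENNReal.ofReal_toReal (measure_ne_top Q A)]
    apply ENNReal.ofReal_le_ofReal
    simp only [measureReal_def] at h3 h4
    linarith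
  have hin : ∀ θ', Measurable fun x => ∫⁻ y, ENNReal.ofReal (M y x ^ p) ∂(m.kernel θ' x) := fun θ' =>
    Measurable.lintegral_kernel_prod_right (f := fun x y => ENNReal.ofReal (M y x ^ p))
      (κ := m.kernel θ') ((h.measurable_M.comp measurable_swap).pow_const p).ennreal_ofReal
  have h0 : 0 ≤ s ^ 2 * (C₁ * v + 2 * B) + (s * a * (2 * X) + s * a ^ (1 - p) * C₁ * v) := by
    positivity
  rw [← ENNReal.ofReal_le_ofReal_iff h0]
  refine (ofReal_integral_le_lintegral _).trans ?_
  rw [← lintegral_add_compl _ hAm, add_comm, ENNReal.ofReal_add (by positivity) (by positivity)]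
  -- Off `A` the second-order bound applies, and its `θ`-moment passes from `Q` to `2 ν`. On `A` the
  -- truncated first-order bound is used.
  apply add_le_add
  · have h1 : ∀ x, ENNReal.ofReal (∫ y, m.stepLog θ₀ θ y x ∂(m.kernel θ₀ x)) ≤
        ENNReal.ofReal (s ^ 2) * (∫⁻ y, ENNReal.ofReal (M y x ^ p) ∂(m.kernel θ₀ x) +
          ∫⁻ y, ENNReal.ofReal (M y x ^ p) ∂(m.kernel θ x)) := by
      intro x
      refine (ofReal_integral_stepLog_le (fun y => h.logClose y x)
        ((h.measurable_M_left x).const_mul s)).trans ?_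
      rw [mul_add, ← lintegral_const_mul' _ _ ENNReal.ofReal_ne_top,
        ← lintegral_const_mul' _ _ ENNReal.ofReal_ne_top]
      have h2 : ∀ y, ENNReal.ofReal ((s * M y x) ^ 2) ≤
          ENNReal.ofReal (s ^ 2) * ENNReal.ofReal (M y x ^ p) := by
        intro y
        rw [← ENNReal.ofReal_mul (by positivity), mul_pow]
        apply ENNReal.ofReal_le_ofReal
        gcongr
        exact h.M_sq_le y x
      exact add_le_add (lintegral_mono h2) (lintegral_mono h2)
    refine (lintegral_mono h1).trans ?_
    rw [lintegral_const_mul' _ _ ENNReal.ofReal_ne_top, lintegral_add_left (hin θ₀),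
      ENNReal.ofReal_mul (by positivity), ENNReal.ofReal_add (by positivity) (by positivity)]
    gcongr
    · refine (setLIntegral_le_lintegral _ _).trans ((lintegral_mono hMV).trans ?_)
      simp_rw [ENNReal.ofReal_mul hC₁]
      rw [lintegral_const_mul' _ _ ENNReal.ofReal_ne_top, hVv]
    · refine (setLIntegral_densityLaw_le hq.measurable hq'.measurable (hin θ)).trans ?_
      rw [ENNReal.ofReal_mul (by norm_num), ENNReal.ofReal_ofNat]
      gcongr
      exact h.moment
  · refine (lintegral_mono fun x => h.ofReal_integral_stepLog_le_mul hC₁ hMV ha x).trans ?_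
    rw [lintegral_add_left measurable_const, lintegral_const_mul' _ _ ENNReal.ofReal_ne_top,
      lintegral_const, Measure.restrict_apply_univ, ENNReal.ofReal_add (by positivity) (by positivity),
      ENNReal.ofReal_mul (p := s * a) (by positivity),
      ENNReal.ofReal_mul (p := s * a ^ (1 - p) * C₁) (by positivity), ← hVv]
    gcongr
    exact Measure.restrict_le_self

theorem exists_integral_stepLog_le (hp : 2 < p) (hq : IsProbDensity μ q)
    (hG : GeomErg (m.kernel θ₀) (densityLaw μ q) V r R) {C₁ : ℝ} (hC₁ : 0 ≤ C₁)
    (hMV : ∀ x, ∫⁻ y, ENNReal.ofReal (M y x ^ p) ∂(m.kernel θ₀ x) ≤ ENNReal.ofReal (C₁ * V x)) :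
    ∃ C : ℝ, 0 ≤ C ∧ ∀ (θ : Θ) (q' : S → ℝ) (s : ℝ), IsProbDensity μ q' →
      m.Comparable θ₀ θ (densityLaw μ q') M p B s →
      ∫ x, ∫ y, m.stepLog θ₀ θ y x ∂(m.kernel θ₀ x) ∂(densityLaw μ q) ≤ C * s ^ (3 / 2 : ℝ) := by
  have := hq.isProbabilityMeasure
  obtain ⟨C, hC0, hC⟩ := exists_measure_le (M := M) hG p B
  have hv := hG.one_le_integral
  have hlr : 0 < Real.log r := Real.log_pos hG.one_lt_r
  set v := ∫ x, V x ∂(densityLaw μ q) with hvdef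
  -- The truncation level is `a = s^(-γ)`, with `γ` chosen so that `s a^(1-p) = s^(3/2)`. The other
  -- term is `s² a = s^(3/2) s^η` up to a factor `log (1/s)`, and `p > 2` makes `η` positive, which
  -- absorbs the logarithm.
  set γ : ℝ := 1 / (2 * (p - 1)) with hγ
  have hγ2 : γ < 1 / 2 := by
    rw [hγ]
    apply one_div_lt_one_div_of_lt <;> linarith
  set η : ℝ := 1 / 2 - γ with hη
  have hη0 : 0 < η := by linarith
  refine ⟨(1 + C₁ * v) + (C₁ * v + 2 * |B|) +
    (2 * (C + (1 + 1 / (η * Real.log r)) * |B|) + C₁ * v), by positivity, ?_⟩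
  intro θ q' s hq' h
  have hs := h.nonneg_s
  have hB := h.nonneg_B
  rw [abs_of_nonneg hB]
  -- For `s = 0` and `s ≥ 1` the plain first-order bound is already good enough.
  have hbig : s ≤ s ^ (3 / 2 : ℝ) → ∫ x, ∫ y, m.stepLog θ₀ θ y x ∂(m.kernel θ₀ x) ∂(densityLaw μ q) ≤
      ((1 + C₁ * v) + (C₁ * v + 2 * B) +
        (2 * (C + (1 + 1 / (η * Real.log r)) * B) + C₁ * v)) * s ^ (3 / 2 : ℝ) := by
    intro h1
    refine (h.integral_stepLog_le_mul hq hG hC₁ hMV).trans ?_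
    rw [← hvdef, mul_comm]
    have h2 : 0 ≤ (C₁ * v + 2 * B) := by positivity
    have h3 : 0 ≤ (2 * (C + (1 + 1 / (η * Real.log r)) * B) + C₁ * v) := by positivity
    exact mul_le_mul (by linarith) h1 hs (by positivity)
  rcases hs.eq_or_lt with hs0 | hs0
  · exact hbig (by rw [← hs0]; positivity)
  rcases le_or_gt 1 s with hs1 | hs1
  · exact hbig (Real.self_le_rpow_of_one_le hs1 (by norm_num))
  -- The least number of steps with `r^(-j) ≤ s`, hence of order `log (1/s)`.
  set j : ℕ := ⌈Real.log (1 / s) / Real.log r⌉₊ with hj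
  have hjs : (r ^ j)⁻¹ ≤ s := by
    rw [inv_le_comm₀ (pow_pos hG.r_pos j) hs0, ← one_div,
      ← Real.log_le_log_iff (by positivity) (pow_pos hG.r_pos j), Real.log_pow,
      ← div_le_iff₀ hlr]
    exact Nat.le_ceil _
  have hlog0 : 0 ≤ Real.log (1 / s) := Real.log_nonneg (by rw [le_div_iff₀ hs0]; linarith)
  have hj1 : (j : ℝ) ≤ Real.log (1 / s) / Real.log r + 1 :=
    (Nat.ceil_lt_add_one (by positivity)).le
  have := hq'.isProbabilityMeasure
  have hjη : s ^ η * j ≤ 1 + 1 / (η * Real.log r) := by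
    have h1 : Real.log (1 / s) ≤ (s ^ η)⁻¹ / η := by
      have := Real.log_le_rpow_div (x := 1 / s) (by positivity) hη0
      rwa [one_div, Real.inv_rpow hs, ← one_div] at this
    have hsη : 0 < s ^ η := by positivity
    have h2 : s ^ η ≤ 1 := Real.rpow_le_one hs hs1.le hη0.le
    calc s ^ η * j ≤ s ^ η * ((s ^ η)⁻¹ / η / Real.log r + 1) := by
          gcongr
          refine hj1.trans ?_
          gcongr
      _ = 1 / (η * Real.log r) + s ^ η := by field_simp
      _ ≤ _ := by linarith
  have hX := h.integral_stepLog_le hq hq' hG hC₁ hMV (X := s * (C + j * B)) (by positivity)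
    (hC θ _ inferInstance s hs0 h j hjs) (a := s ^ (-γ)) (by positivity)
  rw [← hvdef] at hX
  have e1 : s * (s ^ (-γ)) ^ (1 - p) = s ^ (3 / 2 : ℝ) := by
    have hp1 : p - 1 ≠ 0 := by linarith
    rw [← Real.rpow_mul hs]
    nth_rewrite 1 [← Real.rpow_one s]
    rw [← Real.rpow_add hs0]
    congr 1
    rw [hγ]
    field_simp
    ring
  have e2 : s * s ^ (-γ) * s = s ^ (3 / 2 : ℝ) * s ^ η := by
    nth_rewrite 1 [← Real.rpow_one s]
    nth_rewrite 3 [← Real.rpow_one s]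
    rw [← Real.rpow_add hs0, ← Real.rpow_add hs0, ← Real.rpow_add hs0]
    congr 1
    rw [hη]
    ring
  have e3 : s ^ 2 ≤ s ^ (3 / 2 : ℝ) := by
    rw [← Real.rpow_two]
    exact Real.rpow_le_rpow_of_exponent_ge hs0 hs1.le (by norm_num)
  set w := s ^ (3 / 2 : ℝ) with hw
  have hw0 : 0 ≤ w := by positivity
  have hη1 : s ^ η ≤ 1 := Real.rpow_le_one hs hs1.le hη0.le
  refine hX.trans ?_
  have t1 : s ^ 2 * (C₁ * v + 2 * B) ≤ w * (C₁ * v + 2 * B) := by gcongr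
  have t2 : s * s ^ (-γ) * (2 * (s * (C + j * B))) ≤
      w * (2 * (C + (1 + 1 / (η * Real.log r)) * B)) := by
    have : s * s ^ (-γ) * (2 * (s * (C + j * B))) = w * (2 * (s ^ η * C + s ^ η * j * B)) := by
      linear_combination (2 * (C + j * B)) * e2
    rw [this]
    have : s ^ η * C ≤ 1 * C := by gcongr
    have : s ^ η * j * B ≤ (1 + 1 / (η * Real.log r)) * B := by gcongr
    gcongr
    linarith
  rw [e1]
  have t3 : 0 ≤ (1 + C₁ * v) * w := by positivity
  linarith

end Comparable

end TransitionModel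

theorem integrable_of_lintegral_sq_lt_top {α : Type*} [MeasurableSpace α] {P : Measure α}
    [IsFiniteMeasure P] {f : α → ℝ} (hf : Measurable f)
    (h : ∫⁻ x, ENNReal.ofReal (f x ^ 2) ∂P < ∞) : Integrable f P := by
  have h2 : Integrable (fun x => f x ^ 2) P := by
    refine ⟨(hf.pow_const 2).aestronglyMeasurable, ?_⟩
    rw [hasFiniteIntegral_iff_ofReal (ae_of_all _ fun x => sq_nonneg _)]
    exact h
  refine ((integrable_const (1 : ℝ)).add h2).mono' hf.aestronglyMeasurable
    (ae_of_all _ fun x => ?_)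
  rw [Real.norm_eq_abs]
  simp only [Pi.add_apply]
  rw [← sq_abs]
  nlinarith [sq_nonneg (|f x| - 1), abs_nonneg (f x)]

/-! ### Path laws, built one state at a time -/

namespace TransitionModel

variable {Θ S : Type*} [MeasurableSpace Θ] [MeasurableSpace S] {μ : Measure S} [SigmaFinite μ]
  (m : TransitionModel Θ S μ)

theorem measurable_jointDensity_uncurry {q₀ : S → ℝ} (hq₀ : Measurable q₀) (n : ℕ) :
    Measurable fun z : Θ × (Fin (n + 1) → S) => m.jointDensity q₀ z.1 n z.2 := by
  unfold jointDensity
  refine (hq₀.comp ((measurable_pi_apply 0).comp measurable_snd)).mul ?_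
  refine Finset.measurable_prod _ fun i _ => ?_
  exact m.measurable_p.comp (by fun_prop :
    Measurable fun z : Θ × (Fin (n + 1) → S) => (z.1, z.2 i.succ, z.2 i.castSucc))

theorem measurable_jointDensity {q₀ : S → ℝ} (hq₀ : Measurable q₀) (θ : Θ) (n : ℕ) :
    Measurable (m.jointDensity q₀ θ n) :=
  (m.measurable_jointDensity_uncurry hq₀ n).comp measurable_prodMk_left

theorem jointDensity_nonneg {q₀ : S → ℝ} (hq₀ : ∀ x, 0 ≤ q₀ x) (θ : Θ) (n : ℕ)
    (x : Fin (n + 1) → S) : 0 ≤ m.jointDensity q₀ θ n x :=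
  mul_nonneg (hq₀ _) (Finset.prod_nonneg fun _ _ => m.nonneg_p _ _ _)

/-- Appending the next state to a finite path. -/
def snocPath (n : ℕ) (z : (Fin (n + 1) → S) × S) : Fin (n + 2) → S :=
  Fin.snoc (α := fun _ => S) z.1 z.2

theorem measurable_snocPath (n : ℕ) : Measurable (snocPath (S := S) n) := by
  refine measurable_pi_lambda _ fun i => ?_
  refine Fin.lastCases ?_ (fun i => ?_) i
  · simpa [snocPath] using measurable_snd
  · simp only [snocPath, Fin.snoc_castSucc]
    fun_prop

@[simp] theorem snocPath_last (n : ℕ) (x : Fin (n + 1) → S) (y : S) :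
    snocPath n (x, y) (Fin.last (n + 1)) = y := by simp [snocPath]

@[simp] theorem snocPath_castSucc (n : ℕ) (x : Fin (n + 1) → S) (y : S) (i : Fin (n + 1)) :
    snocPath n (x, y) i.castSucc = x i := by simp [snocPath]

theorem snocPath_zero (n : ℕ) (x : Fin (n + 1) → S) (y : S) :
    snocPath n (x, y) 0 = x 0 := snocPath_castSucc n x y 0

theorem snocPath_succ_castSucc (n : ℕ) (x : Fin (n + 1) → S) (y : S) (i : Fin n) :
    snocPath n (x, y) i.castSucc.succ = x i.succ := snocPath_castSucc n x y i.succ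

theorem jointDensity_snocPath (q₀ : S → ℝ) (θ : Θ) (n : ℕ) (x : Fin (n + 1) → S) (y : S) :
    m.jointDensity q₀ θ (n + 1) (snocPath n (x, y)) =
      m.jointDensity q₀ θ n x * m.p θ y (x (Fin.last n)) := by
  unfold jointDensity
  rw [Fin.prod_univ_castSucc, snocPath_zero, Fin.succ_last, snocPath_last, snocPath_castSucc,
    ← mul_assoc]
  simp only [snocPath_succ_castSucc, snocPath_castSucc]

theorem lintegral_pi_succ (n : ℕ) {F : (Fin (n + 2) → S) → ℝ≥0∞} (hF : Measurable F) :
    ∫⁻ x, F x ∂(Measure.pi fun _ : Fin (n + 2) => μ) =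
      ∫⁻ x, ∫⁻ y, F (snocPath n (x, y)) ∂μ ∂(Measure.pi fun _ : Fin (n + 1) => μ) := by
  have h := (measurePreserving_piFinSuccAbove (fun _ : Fin (n + 2) => μ) (Fin.last (n + 1))).symm
  rw [← h.lintegral_comp hF]
  have hG : Measurable fun z : S × (Fin (n + 1) → S) => F (snocPath n (z.2, z.1)) :=
    hF.comp ((measurable_snocPath n).comp measurable_swap)
  have e : ∀ z : S × (Fin (n + 1) → S),
      F ((MeasurableEquiv.piFinSuccAbove (fun _ => S) (Fin.last (n + 1))).symm z) =
        F (snocPath n (z.2, z.1)) := by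
    intro z
    congr 1
    rw [MeasurableEquiv.piFinSuccAbove_symm_apply]
    simp only [Fin.insertNthEquiv, Equiv.coe_fn_mk, Fin.insertNth_last', snocPath]
  rw [lintegral_congr e]
  exact lintegral_prod_symm _ hG.aemeasurable

theorem lintegral_law_succ {q₀ : S → ℝ} (hq₀ : IsProbDensity μ q₀) (θ : Θ) (n : ℕ)
    {F : (Fin (n + 2) → S) → ℝ≥0∞} (hF : Measurable F) :
    ∫⁻ x, F x ∂(m.law q₀ θ (n + 1)) =
      ∫⁻ x, ∫⁻ y, F (snocPath n (x, y)) ∂(m.kernel θ (x (Fin.last n))) ∂(m.law q₀ θ n) := by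
  have hj := fun k => (m.measurable_jointDensity hq₀.measurable θ k).ennreal_ofReal
  have hFs : Measurable fun z => F (snocPath n z) := hF.comp (measurable_snocPath n)
  have hin : Measurable fun x : Fin (n + 1) → S =>
      ∫⁻ y, F (snocPath n (x, y)) ∂(m.kernel θ (x (Fin.last n))) :=
    Measurable.lintegral_kernel_prod_right (f := fun x y => F (snocPath n (x, y)))
      (κ := (m.kernel θ).comap (fun x : Fin (n + 1) → S => x (Fin.last n))
        (measurable_pi_apply _)) hFs
  rw [law, law, lintegral_withDensity_eq_lintegral_mul _ (hj _) hF,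
    lintegral_withDensity_eq_lintegral_mul _ (hj _) hin, lintegral_pi_succ n ((hj _).mul hF)]
  refine lintegral_congr fun x => ?_
  simp only [Pi.mul_apply]
  rw [m.lintegral_kernel θ _ (f := fun y => F (snocPath n (x, y)))
      (hFs.comp measurable_prodMk_left),
    ← lintegral_const_mul' _ _ ENNReal.ofReal_ne_top]
  refine lintegral_congr fun y => ?_
  rw [jointDensity_snocPath, ENNReal.ofReal_mul (m.jointDensity_nonneg hq₀.nonneg θ n x), mul_assoc]

theorem measurable_constPath : Measurable fun (x : S) (_ : Fin (0 + 1)) => x :=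
  measurable_pi_lambda _ fun _ => measurable_id

theorem law_zero {q₀ : S → ℝ} (hq₀ : IsProbDensity μ q₀) (θ : Θ) :
    m.law q₀ θ 0 = (densityLaw μ q₀).map fun x _ => x := by
  have hc := measurable_constPath (S := S)
  have hj := (m.measurable_jointDensity hq₀.measurable θ 0).ennreal_ofReal
  refine Measure.ext_of_lintegral _ fun F hF => ?_
  rw [lintegral_map hF hc, law, densityLaw, lintegral_withDensity_eq_lintegral_mul _ hj hF,
    lintegral_withDensity_eq_lintegral_mul _ hq₀.measurable.ennreal_ofReal
      (g := fun x => F fun _ => x) (hF.comp hc)]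
  have h := (measurePreserving_funUnique μ (Fin 1)).symm
  refine (h.lintegral_comp (hj.mul hF)).symm.trans (lintegral_congr fun x => ?_)
  simp [jointDensity, MeasurableEquiv.funUnique]
  rfl

theorem isProbabilityMeasure_law {q₀ : S → ℝ} (hq₀ : IsProbDensity μ q₀) (θ : Θ) (n : ℕ) :
    IsProbabilityMeasure (m.law q₀ θ n) := by
  induction n with
  | zero =>
    have := hq₀.isProbabilityMeasure
    rw [m.law_zero hq₀]
    exact Measure.isProbabilityMeasure_map measurable_constPath.aemeasurable
  | succ n ih =>
    constructor
    have := m.lintegral_law_succ hq₀ θ n (F := fun _ => 1) measurable_const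
    simpa using this

/-- The kernel of the next state given a finite path. -/
noncomputable def lastKernel (θ : Θ) (n : ℕ) : Kernel (Fin (n + 1) → S) S :=
  (m.kernel θ).comap (fun x => x (Fin.last n)) (measurable_pi_apply _)

instance (θ : Θ) (n : ℕ) : IsMarkovKernel (m.lastKernel θ n) := by
  unfold lastKernel; infer_instance

theorem law_succ {q₀ : S → ℝ} (hq₀ : IsProbDensity μ q₀) (θ : Θ) (n : ℕ) :
    m.law q₀ θ (n + 1) = (m.law q₀ θ n ⊗ₘ m.lastKernel θ n).map (snocPath n) := by
  have := m.isProbabilityMeasure_law hq₀ θ n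
  refine Measure.ext_of_lintegral _ fun F hF => ?_
  rw [lintegral_map hF (measurable_snocPath n), m.lintegral_law_succ hq₀ θ n hF,
    Measure.lintegral_compProd (f := fun z => F (snocPath n z))
      (hF.comp (measurable_snocPath n))]
  rfl

theorem integral_law_succ {q₀ : S → ℝ} (hq₀ : IsProbDensity μ q₀) (θ : Θ) (n : ℕ)
    {F : (Fin (n + 2) → S) → ℝ} (hF : Measurable F) (hFi : Integrable F (m.law q₀ θ (n + 1))) :
    ∫ x, F x ∂(m.law q₀ θ (n + 1)) =
      ∫ x, ∫ y, F (snocPath n (x, y)) ∂(m.kernel θ (x (Fin.last n))) ∂(m.law q₀ θ n) := by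
  have := m.isProbabilityMeasure_law hq₀ θ n
  rw [m.law_succ hq₀] at hFi ⊢
  rw [integrable_map_measure hF.aestronglyMeasurable (measurable_snocPath n).aemeasurable] at hFi
  rw [integral_map (measurable_snocPath n).aemeasurable hF.aestronglyMeasurable]
  exact Measure.integral_compProd hFi

theorem lintegral_law_last {q₀ : S → ℝ} (hq₀ : IsProbDensity μ q₀) (θ : Θ) (n : ℕ)
    {f : S → ℝ≥0∞} (hf : Measurable f) :
    ∫⁻ x, f (x (Fin.last n)) ∂(m.law q₀ θ n) =
      ∫⁻ x, ∫⁻ y, f y ∂((m.kernel θ ^ n) x) ∂(densityLaw μ q₀) := by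
  induction n generalizing f with
  | zero =>
    rw [m.law_zero hq₀, lintegral_map (f := fun x : Fin (0 + 1) → S => f (x (Fin.last 0)))
      (hf.comp (measurable_pi_apply _)) measurable_constPath]
    simp_rw [lintegral_pow_zero _ _ hf]
  | succ n ih =>
    rw [m.lintegral_law_succ hq₀ θ n (F := fun x => f (x (Fin.last (n + 1))))
      (hf.comp (measurable_pi_apply _))]
    simp only [snocPath_last]
    rw [ih (f := fun x => ∫⁻ y, f y ∂(m.kernel θ x)) (hf.lintegral_kernel (κ := m.kernel θ))]
    simp_rw [lintegral_pow_succ' _ n _ hf]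

/-- The log-likelihood ratio as a sum over the steps of the path. -/
noncomputable def sumLog (θ₀ θ : Θ) (n : ℕ) (x : Fin (n + 1) → S) : ℝ :=
  ∑ i : Fin n, m.stepLog θ₀ θ (x i.succ) (x i.castSucc)

theorem measurable_sumLog (θ₀ θ : Θ) (n : ℕ) : Measurable (m.sumLog θ₀ θ n) :=
  Finset.measurable_sum _ fun i _ => (m.measurable_stepLog θ₀ θ).comp
    (by fun_prop : Measurable fun x : Fin (n + 1) → S => (x i.succ, x i.castSucc))

theorem sumLog_snocPath (θ₀ θ : Θ) (n : ℕ) (x : Fin (n + 1) → S) (y : S) :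
    m.sumLog θ₀ θ (n + 1) (snocPath n (x, y)) =
      m.sumLog θ₀ θ n x + m.stepLog θ₀ θ y (x (Fin.last n)) := by
  unfold sumLog
  rw [Fin.sum_univ_castSucc, Fin.succ_last, snocPath_last, snocPath_castSucc]
  simp only [snocPath_succ_castSucc, snocPath_castSucc]

/-- The common factor `q₀` cancels, and equality of the zero sets makes every logarithm genuine. The
exceptional paths are null under the law of `θ₀`. -/
theorem logRatio_eq_sumLog {q₀ : S → ℝ} {θ₀ θ : Θ}
    (h0 : ∀ y x, m.p θ₀ y x = 0 ↔ m.p θ y x = 0) (n : ℕ) {x : Fin (n + 1) → S}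
    (hx : m.jointDensity q₀ θ₀ n x ≠ 0) :
    m.logRatio q₀ θ θ₀ n x = m.sumLog θ₀ θ n x := by
  unfold jointDensity at hx
  have hx0 := left_ne_zero_of_mul hx
  have hx1 : ∀ i : Fin n, m.p θ₀ (x i.succ) (x i.castSucc) ≠ 0 := fun i =>
    Finset.prod_ne_zero_iff.1 (right_ne_zero_of_mul hx) i (Finset.mem_univ i)
  have hx2 : ∀ i : Fin n, m.p θ (x i.succ) (x i.castSucc) ≠ 0 := fun i =>
    fun h => hx1 i ((h0 _ _).2 h)
  unfold logRatio jointDensity sumLog stepLog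
  rw [mul_div_mul_left _ _ hx0, Real.log_div (Finset.prod_ne_zero_iff.2 fun i _ => hx1 i)
    (Finset.prod_ne_zero_iff.2 fun i _ => hx2 i), Real.log_prod fun i _ => hx1 i,
    Real.log_prod fun i _ => hx2 i, Finset.sum_sub_distrib]

theorem logRatio_ae_eq_sumLog {q₀ : S → ℝ} (hq₀ : IsProbDensity μ q₀) {θ₀ θ : Θ}
    (h0 : ∀ y x, m.p θ₀ y x = 0 ↔ m.p θ y x = 0) (n : ℕ) :
    m.logRatio q₀ θ θ₀ n =ᵐ[m.law q₀ θ₀ n] m.sumLog θ₀ θ n := by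
  have hj := m.measurable_jointDensity hq₀.measurable θ₀ n
  rw [Filter.EventuallyEq, law, ae_withDensity_iff hj.ennreal_ofReal]
  refine ae_of_all _ fun x hx => m.logRatio_eq_sumLog h0 n fun h => hx (by simp [h])

end TransitionModel

/-! ### Second moments under a probability measure -/

section SecondMoments

variable {α : Type*} [MeasurableSpace α] {P : Measure α} [IsProbabilityMeasure P] {f : α → ℝ}

theorem integrable_of_integrable_sq (hf : Measurable f) (h : Integrable (fun x => f x ^ 2) P) :
    Integrable f P := by
  refine integrable_of_lintegral_sq_lt_top hf ?_
  rw [← ofReal_integral_eq_lintegral_ofReal h (ae_of_all _ fun _ => sq_nonneg _)]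
  exact ENNReal.ofReal_lt_top

theorem integral_add_sq (hf : Measurable f) (h : Integrable (fun x => f x ^ 2) P) (t : ℝ) :
    ∫ x, (t + f x) ^ 2 ∂P = (t + ∫ x, f x ∂P) ^ 2 + (∫ x, f x ^ 2 ∂P - (∫ x, f x ∂P) ^ 2) := by
  have h1 := integrable_of_integrable_sq hf h
  have e : ∀ x, (t + f x) ^ 2 = t ^ 2 + 2 * t * f x + f x ^ 2 := fun x => by ring
  simp_rw [e]
  have h2 : Integrable (fun x => t ^ 2 + 2 * t * f x) P :=
    (integrable_const _).add (h1.const_mul _)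
  rw [integral_add h2 h, integral_add (integrable_const _) (h1.const_mul _), integral_const_mul,
    integral_const]
  simp only [probReal_univ, one_smul]
  ring

theorem sq_integral_le (hf : Measurable f) (h : Integrable (fun x => f x ^ 2) P) :
    (∫ x, f x ∂P) ^ 2 ≤ ∫ x, f x ^ 2 ∂P := by
  have h1 := integral_add_sq hf h (-∫ x, f x ∂P)
  have h2 : 0 ≤ ∫ x, (-∫ x, f x ∂P + f x) ^ 2 ∂P := integral_nonneg fun x => sq_nonneg _
  rw [h1] at h2
  simpa using h2

theorem lintegral_add_sq_le (hf : Measurable f) (h : Integrable (fun x => f x ^ 2) P) (t : ℝ) :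
    ∫⁻ x, ENNReal.ofReal ((t + f x) ^ 2) ∂P ≤
      ENNReal.ofReal ((t + ∫ x, f x ∂P) ^ 2) + ENNReal.ofReal (∫ x, f x ^ 2 ∂P) := by
  have h1 := integrable_of_integrable_sq hf h
  have hi : Integrable (fun x => (t + f x) ^ 2) P := by
    have e : (fun x => (t + f x) ^ 2) = fun x => (t ^ 2 + 2 * t * f x) + f x ^ 2 := by
      ext x; ring
    rw [e]
    exact ((integrable_const _).add (h1.const_mul _)).add h
  rw [← ofReal_integral_eq_lintegral_ofReal hi (ae_of_all _ fun _ => sq_nonneg _),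
    ← ENNReal.ofReal_add (sq_nonneg _) (integral_nonneg fun _ => sq_nonneg _),
    integral_add_sq hf h]
  apply ENNReal.ofReal_le_ofReal
  linarith [sq_nonneg (∫ x, f x ∂P)]

end SecondMoments

/-! ### Mean and fluctuations of the log-ratio along a path -/

namespace TransitionModel

variable {Θ S : Type*} [MeasurableSpace Θ] [MeasurableSpace S] {μ : Measure S} [SigmaFinite μ]
  {m : TransitionModel Θ S μ} {θ₀ θ : Θ} {V : S → ℝ} {b : ℝ}

/-- The mean one-step log-likelihood ratio at a state. -/
noncomputable def meanStep (m : TransitionModel Θ S μ) (θ₀ θ : Θ) (x : S) : ℝ :=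
  ∫ y, m.stepLog θ₀ θ y x ∂(m.kernel θ₀ x)

theorem measurable_meanStep (m : TransitionModel Θ S μ) (θ₀ θ : Θ) :
    Measurable (m.meanStep θ₀ θ) :=
  (StronglyMeasurable.integral_kernel_prod_right (κ := m.kernel θ₀)
    (f := fun x y => m.stepLog θ₀ θ y x)
    ((m.measurable_stepLog θ₀ θ).comp measurable_swap).stronglyMeasurable).measurable

theorem integrable_stepLog_sq
    (hZ : ∀ x, ∫⁻ y, ENNReal.ofReal (m.stepLog θ₀ θ y x ^ 2) ∂(m.kernel θ₀ x) ≤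
      ENNReal.ofReal (b ^ 2 * V x)) (x : S) :
    Integrable (fun y => m.stepLog θ₀ θ y x ^ 2) (m.kernel θ₀ x) := by
  refine ⟨((m.measurable_stepLog_left θ₀ θ x).pow_const 2).aestronglyMeasurable, ?_⟩
  rw [hasFiniteIntegral_iff_ofReal (ae_of_all _ fun x => sq_nonneg _)]
  exact (hZ x).trans_lt ENNReal.ofReal_lt_top

theorem integral_stepLog_sq_le (hV : ∀ x, 0 ≤ V x)
    (hZ : ∀ x, ∫⁻ y, ENNReal.ofReal (m.stepLog θ₀ θ y x ^ 2) ∂(m.kernel θ₀ x) ≤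
      ENNReal.ofReal (b ^ 2 * V x)) (x : S) :
    ∫ y, m.stepLog θ₀ θ y x ^ 2 ∂(m.kernel θ₀ x) ≤ b ^ 2 * V x := by
  rw [← ENNReal.ofReal_le_ofReal_iff (mul_nonneg (sq_nonneg b) (hV x)),
    ofReal_integral_eq_lintegral_ofReal (integrable_stepLog_sq hZ x)
      (ae_of_all _ fun _ => sq_nonneg _)]
  exact hZ x

/-- Cauchy-Schwarz. This places the mean step at the scale `√V` required by the Poisson bounds. -/
theorem abs_meanStep_le (hV : ∀ x, 0 ≤ V x) (hb : 0 ≤ b)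
    (hZ : ∀ x, ∫⁻ y, ENNReal.ofReal (m.stepLog θ₀ θ y x ^ 2) ∂(m.kernel θ₀ x) ≤
      ENNReal.ofReal (b ^ 2 * V x)) (x : S) :
    |m.meanStep θ₀ θ x| ≤ b * √(V x) := by
  have h1 := sq_integral_le (m.measurable_stepLog_left θ₀ θ x) (integrable_stepLog_sq hZ x)
  apply abs_le_of_sq_le_sq _ (by positivity)
  rw [mul_pow, Real.sq_sqrt (hV x)]
  exact h1.trans (integral_stepLog_sq_le hV hZ x)

/-- The compensated log-likelihood ratio of a path, corrected by the solution of the Poisson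
equation at the end point. -/
noncomputable def compSum (m : TransitionModel Θ S μ) (θ₀ θ : Θ) (Q : Measure S) (n k : ℕ)
    (x : Fin (n + 1) → S) : ℝ :=
  m.sumLog θ₀ θ n x - n * ∫ z, m.meanStep θ₀ θ z ∂Q +
    poissonSum (m.kernel θ₀) Q (m.meanStep θ₀ θ) k (x (Fin.last n))

theorem measurable_compSum (m : TransitionModel Θ S μ) (θ₀ θ : Θ) (Q : Measure S) (n k : ℕ) :
    Measurable (m.compSum θ₀ θ Q n k) :=
  ((m.measurable_sumLog θ₀ θ n).sub_const _).add
    ((measurable_poissonSum _ Q (m.measurable_meanStep θ₀ θ) k).comp (measurable_pi_apply _))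

variable {Q : Measure S} [IsProbabilityMeasure Q] {r R : ℝ}

/-- The increment of the compensated log-likelihood ratio. -/
noncomputable def compStep (m : TransitionModel Θ S μ) (θ₀ θ : Θ) (Q : Measure S) (k : ℕ)
    (y x : S) : ℝ :=
  m.stepLog θ₀ θ y x - ∫ z, m.meanStep θ₀ θ z ∂Q +
    poissonSum (m.kernel θ₀) Q (m.meanStep θ₀ θ) k y

theorem compSum_snocPath (n k : ℕ) (x : Fin (n + 1) → S) (y : S) :
    m.compSum θ₀ θ Q (n + 1) k (snocPath n (x, y)) =
      (m.sumLog θ₀ θ n x - n * ∫ z, m.meanStep θ₀ θ z ∂Q) +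
        m.compStep θ₀ θ Q k y (x (Fin.last n)) := by
  rw [compSum, sumLog_snocPath, snocPath_last, compStep]
  push_cast
  ring

theorem measurable_compStep (k : ℕ) (x : S) : Measurable fun y => m.compStep θ₀ θ Q k y x :=
  ((m.measurable_stepLog_left θ₀ θ x).sub_const _).add
    (measurable_poissonSum _ Q (m.measurable_meanStep θ₀ θ) k)

/-- The martingale property: by the truncated Poisson equation, averaging over the next state
absorbs the centred step and raises the corrector from level `k` to level `k + 1`. -/
theorem integral_compStep (hG : GeomErg (m.kernel θ₀) Q V r R) (hb : 0 ≤ b)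
    (hZ : ∀ x, ∫⁻ y, ENNReal.ofReal (m.stepLog θ₀ θ y x ^ 2) ∂(m.kernel θ₀ x) ≤
      ENNReal.ofReal (b ^ 2 * V x)) (k : ℕ) (x : S) :
    ∫ y, m.compStep θ₀ θ Q k y x ∂(m.kernel θ₀ x) =
      poissonSum (m.kernel θ₀) Q (m.meanStep θ₀ θ) (k + 1) x := by
  have hg := abs_meanStep_le (fun x => (hG.V_pos x).le) hb hZ
  have hgm := m.measurable_meanStep θ₀ θ
  obtain ⟨D, hD, hbound⟩ := hG.exists_poissonSum_bound
  have hu := hbound _ b hb hgm hg k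
  have hi := integrable_of_integrable_sq (m.measurable_stepLog_left θ₀ θ x)
    (integrable_stepLog_sq hZ x)
  have hui : Integrable (poissonSum (m.kernel θ₀) Q (m.meanStep θ₀ θ) k) (m.kernel θ₀ x) :=
    hG.integrable_of_abs_le (hG.integrable_V_kernel x)
      (measurable_poissonSum _ Q hgm k) hu
  have hi' : Integrable (fun y => m.stepLog θ₀ θ y x - ∫ z, m.meanStep θ₀ θ z ∂Q)
      (m.kernel θ₀ x) := hi.sub (integrable_const _)
  unfold compStep
  rw [integral_add hi' hui, integral_sub hi (integrable_const _),
    hG.poissonSum_succ hgm hg, integral_const]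
  simp [meanStep]

theorem exists_compStep_sq_le (hG : GeomErg (m.kernel θ₀) Q V r R) : ∃ D : ℝ, 0 < D ∧
    ∀ (θ : Θ) (b : ℝ), 0 ≤ b →
    (∀ x, ∫⁻ y, ENNReal.ofReal (m.stepLog θ₀ θ y x ^ 2) ∂(m.kernel θ₀ x) ≤
      ENNReal.ofReal (b ^ 2 * V x)) → ∀ (k : ℕ) (x : S),
    Integrable (fun y => m.compStep θ₀ θ Q k y x ^ 2) (m.kernel θ₀ x) ∧
    ∫ y, m.compStep θ₀ θ Q k y x ^ 2 ∂(m.kernel θ₀ x) ≤ b ^ 2 * (D * V x) := by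
  obtain ⟨D, hD, hbound⟩ := hG.exists_poissonSum_bound
  have hv := hG.one_le_integral
  have hR := hG.R_pos
  set v := ∫ y, V y ∂Q with hvdef
  refine ⟨3 * (1 + v + D ^ 2 * (v + R)), by positivity, ?_⟩
  intro θ b hb hZ k x
  have hg := abs_meanStep_le (fun x => (hG.V_pos x).le) hb hZ
  have hgm := m.measurable_meanStep θ₀ θ
  have hu := hbound _ b hb hgm hg k
  have hVx := hG.one_le_V x
  have hmean : (∫ z, m.meanStep θ₀ θ z ∂Q) ^ 2 ≤ b ^ 2 * v := by
    have h1 := hG.abs_integral_le hG.integrable_V (by linarith) le_rfl hb hg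
    rw [← sq_abs]
    calc _ ≤ (b * √v) ^ 2 := by gcongr
      _ = _ := by rw [mul_pow, Real.sq_sqrt (by linarith)]
  set a := ∫ z, m.meanStep θ₀ θ z ∂Q with ha
  have hZi := integrable_stepLog_sq hZ x
  have hVi := hG.integrable_V_kernel x
  have hpt : ∀ y, m.compStep θ₀ θ Q k y x ^ 2 ≤
      3 * m.stepLog θ₀ θ y x ^ 2 + (3 * b ^ 2 * v + 3 * b ^ 2 * D ^ 2 * V y) := by
    intro y
    have h1 : poissonSum (m.kernel θ₀) Q (m.meanStep θ₀ θ) k y ^ 2 ≤ b ^ 2 * D ^ 2 * V y := by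
      rw [← sq_abs]
      calc _ ≤ (b * D * √(V y)) ^ 2 := by gcongr; exact hu y
        _ = _ := by rw [mul_pow, Real.sq_sqrt (hG.V_pos y).le]; ring
    rw [compStep, ← ha]
    set A := m.stepLog θ₀ θ y x
    set E := poissonSum (m.kernel θ₀) Q (m.meanStep θ₀ θ) k y
    nlinarith [sq_nonneg (A + a), sq_nonneg (A - E), sq_nonneg (a + E)]
  have hdi : Integrable (fun y => 3 * m.stepLog θ₀ θ y x ^ 2 +
      (3 * b ^ 2 * v + 3 * b ^ 2 * D ^ 2 * V y)) (m.kernel θ₀ x) :=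
    (hZi.const_mul 3).add ((integrable_const _).add (hVi.const_mul _))
  have hsi : Integrable (fun y => m.compStep θ₀ θ Q k y x ^ 2) (m.kernel θ₀ x) :=
    hdi.mono' ((measurable_compStep k x).pow_const 2).aestronglyMeasurable
      (ae_of_all _ fun y => by
        rw [Real.norm_eq_abs, abs_of_nonneg (sq_nonneg _)]; exact hpt y)
  refine ⟨hsi, (integral_mono hsi hdi hpt).trans ?_⟩
  have hci : Integrable (fun y => 3 * b ^ 2 * v + 3 * b ^ 2 * D ^ 2 * V y) (m.kernel θ₀ x) :=
    (integrable_const _).add (hVi.const_mul _)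
  rw [integral_add (hZi.const_mul 3) hci, integral_add (integrable_const _) (hVi.const_mul _),
    integral_const, integral_const_mul, integral_const_mul]
  simp only [probReal_univ, one_smul]
  have h2 := integral_stepLog_sq_le (fun x => (hG.V_pos x).le) hZ x
  have h3 := hG.integral_V_le x
  rw [← hvdef] at h3
  have h4 : b ^ 2 * v ≤ b ^ 2 * v * V x := le_mul_of_one_le_right (by positivity) hVx
  have h5 : b ^ 2 * D ^ 2 * ∫ y, V y ∂(m.kernel θ₀ x) ≤ b ^ 2 * D ^ 2 * ((v + R) * V x) := by
    gcongr
  linarith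

/-- Mean and mean square of the log-likelihood ratio of a path. -/
theorem exists_sumLog_bounds {q₀ : S → ℝ} (hq₀ : IsProbDensity μ q₀)
    (hG : GeomErg (m.kernel θ₀) Q V r R) (hV₀ : Integrable V (densityLaw μ q₀)) :
    ∃ C : ℝ, 0 ≤ C ∧ ∀ (θ : Θ) (b : ℝ), 0 ≤ b →
    (∀ x, ∫⁻ y, ENNReal.ofReal (m.stepLog θ₀ θ y x ^ 2) ∂(m.kernel θ₀ x) ≤
      ENNReal.ofReal (b ^ 2 * V x)) → ∀ n : ℕ,
    Integrable (m.sumLog θ₀ θ n) (m.law q₀ θ₀ n) ∧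
    |∫ x, m.sumLog θ₀ θ n x ∂(m.law q₀ θ₀ n) - n * ∫ z, m.meanStep θ₀ θ z ∂Q| ≤ C * b ∧
    ∫⁻ x, ENNReal.ofReal ((m.sumLog θ₀ θ n x - n * ∫ z, m.meanStep θ₀ θ z ∂Q) ^ 2)
      ∂(m.law q₀ θ₀ n) ≤ ENNReal.ofReal (C * b ^ 2 * (n + 1)) := by
  obtain ⟨D, hD, hbound⟩ := hG.exists_poissonSum_bound
  obtain ⟨D', hD', hstep⟩ := exists_compStep_sq_le (m := m) hG
  have := hq₀.isProbabilityMeasure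
  have hlaw := fun n => m.isProbabilityMeasure_law hq₀ θ₀ n
  have hv := hG.one_le_integral
  have hR := hG.R_pos
  have hV0 : ∀ x, 0 ≤ V x := fun x => (hG.V_pos x).le
  have hΛ : 1 ≤ ∫ x, V x ∂(densityLaw μ q₀) := by
    have := integral_mono (integrable_const (1 : ℝ)) hV₀ hG.one_le_V
    simpa using this
  set v := ∫ y, V y ∂Q with hvdef
  set Λ := ∫ x, V x ∂(densityLaw μ q₀) with hΛdef
  -- The moment of `V` stays bounded along the chain started from `q₀`, uniformly in time.
  have hVn : ∀ n, ∫⁻ x, ENNReal.ofReal (V (x (Fin.last n))) ∂(m.law q₀ θ₀ n) ≤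
      ENNReal.ofReal ((v + R) * Λ) := by
    intro n
    rw [m.lintegral_law_last hq₀ θ₀ n hG.measurable_V.ennreal_ofReal,
      ENNReal.ofReal_mul (by positivity), hΛdef,
      ofReal_integral_eq_lintegral_ofReal hV₀ (ae_of_all _ hV0),
      ← lintegral_const_mul' _ _ ENNReal.ofReal_ne_top]
    refine lintegral_mono fun x => ?_
    have := isMarkovKernel_pow (m.kernel θ₀) n
    rw [← ofReal_integral_eq_lintegral_ofReal (hG.integrable_V_pow n x) (ae_of_all _ hV0),
      ← ENNReal.ofReal_mul (by positivity)]
    exact ENNReal.ofReal_le_ofReal (hG.integral_V_pow_le' n x)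
  refine ⟨D * √Λ + (D ^ 2 * Λ + D' * ((v + R) * Λ)), by positivity, ?_⟩
  intro θ b hb hZ
  have hg := abs_meanStep_le hV0 hb hZ
  have hgm := m.measurable_meanStep θ₀ θ
  have hu := fun k => hbound _ b hb hgm hg k
  have hTm := m.measurable_compSum θ₀ θ Q
  set a := ∫ z, m.meanStep θ₀ θ z ∂Q with ha
  have hT0 : ∀ k (x : S), m.compSum θ₀ θ Q 0 k (fun _ => x) =
      poissonSum (m.kernel θ₀) Q (m.meanStep θ₀ θ) k x := by
    intro k x
    simp [compSum, sumLog]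
  have hL0 : ∀ k, ∫⁻ x, ENNReal.ofReal (m.compSum θ₀ θ Q 0 k x ^ 2) ∂(m.law q₀ θ₀ 0) ≤
      ENNReal.ofReal (b ^ 2 * (D ^ 2 * Λ)) := by
    intro k
    rw [m.law_zero hq₀, lintegral_map ((hTm 0 k).pow_const 2).ennreal_ofReal measurable_constPath,
      ← mul_assoc, ENNReal.ofReal_mul (by positivity), hΛdef,
      ofReal_integral_eq_lintegral_ofReal hV₀ (ae_of_all _ hV0),
      ← lintegral_const_mul' _ _ ENNReal.ofReal_ne_top]
    refine lintegral_mono fun x => ?_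
    rw [hT0, ← ENNReal.ofReal_mul (by positivity)]
    apply ENNReal.ofReal_le_ofReal
    rw [← sq_abs]
    calc _ ≤ (b * D * √(V x)) ^ 2 := by gcongr; exact hu k x
      _ = _ := by rw [mul_pow, Real.sq_sqrt (hV0 x)]; ring
  -- Conditionally on the past, the mean at time `n + 1` and level `k` is the sum at time `n` and
  -- level `k + 1`; the conditional variance is at most `b² D' V` of the current state.
  have hsucc : ∀ n k, ∫⁻ x, ENNReal.ofReal (m.compSum θ₀ θ Q (n + 1) k x ^ 2)
      ∂(m.law q₀ θ₀ (n + 1)) ≤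
      ∫⁻ x, ENNReal.ofReal (m.compSum θ₀ θ Q n (k + 1) x ^ 2) ∂(m.law q₀ θ₀ n) +
        ENNReal.ofReal (b ^ 2 * (D' * ((v + R) * Λ))) := by
    intro n k
    rw [m.lintegral_law_succ hq₀ θ₀ n ((hTm _ k).pow_const 2).ennreal_ofReal]
    have h1 : ∀ x : Fin (n + 1) → S,
        ∫⁻ y, ENNReal.ofReal (m.compSum θ₀ θ Q (n + 1) k (snocPath n (x, y)) ^ 2)
          ∂(m.kernel θ₀ (x (Fin.last n))) ≤
        ENNReal.ofReal (m.compSum θ₀ θ Q n (k + 1) x ^ 2) +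
          ENNReal.ofReal (b ^ 2 * D') * ENNReal.ofReal (V (x (Fin.last n))) := by
      intro x
      obtain ⟨hi, hle⟩ := hstep θ b hb hZ k (x (Fin.last n))
      simp_rw [compSum_snocPath]
      refine (lintegral_add_sq_le (measurable_compStep k _) hi _).trans ?_
      rw [integral_compStep hG hb hZ, ← ENNReal.ofReal_mul (by positivity)]
      refine add_le_add le_rfl (ENNReal.ofReal_le_ofReal ?_)
      linarith
    refine (lintegral_mono h1).trans ?_
    rw [lintegral_add_left ((hTm n _).pow_const 2).ennreal_ofReal,
      lintegral_const_mul' _ _ ENNReal.ofReal_ne_top, ← mul_assoc,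
      ENNReal.ofReal_mul (p := b ^ 2 * D') (by positivity)]
    gcongr
    exact hVn n
  -- The induction must cover all levels at once, since each step back in time raises `k`.
  -- Uniformity of `D` in `k` keeps the initial term bounded.
  have hL : ∀ n k, ∫⁻ x, ENNReal.ofReal (m.compSum θ₀ θ Q n k x ^ 2) ∂(m.law q₀ θ₀ n) ≤
      ENNReal.ofReal (b ^ 2 * (D ^ 2 * Λ) + n * (b ^ 2 * (D' * ((v + R) * Λ)))) := by
    intro n
    induction n with
    | zero => intro k; simpa using hL0 k
    | succ n ih =>
      intro k
      refine (hsucc n k).trans ((add_le_add (ih (k + 1)) le_rfl).trans ?_)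
      rw [← ENNReal.ofReal_add (by positivity) (by positivity)]
      apply ENNReal.ofReal_le_ofReal
      push_cast
      linarith
  have hTi : ∀ n k, Integrable (m.compSum θ₀ θ Q n k) (m.law q₀ θ₀ n) := fun n k =>
    integrable_of_lintegral_sq_lt_top (hTm n k) ((hL n k).trans_lt ENNReal.ofReal_lt_top)
  have hE : ∀ n k, |∫ x, m.compSum θ₀ θ Q n k x ∂(m.law q₀ θ₀ n)| ≤ b * D * √Λ := by
    intro n
    induction n with
    | zero =>
      intro k
      rw [m.law_zero hq₀, integral_map measurable_constPath.aemeasurable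
        (hTm 0 k).aestronglyMeasurable]
      simp_rw [hT0]
      exact hG.abs_integral_le hV₀ (by linarith) le_rfl (by positivity) (hu k)
    | succ n ih =>
      intro k
      rw [m.integral_law_succ hq₀ θ₀ n (hTm _ k) (hTi _ k)]
      have h1 : ∀ x : Fin (n + 1) → S,
          ∫ y, m.compSum θ₀ θ Q (n + 1) k (snocPath n (x, y)) ∂(m.kernel θ₀ (x (Fin.last n))) =
            m.compSum θ₀ θ Q n (k + 1) x := by
        intro x
        obtain ⟨hi, -⟩ := hstep θ b hb hZ k (x (Fin.last n))
        simp_rw [compSum_snocPath]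
        rw [integral_add (integrable_const _)
          (integrable_of_integrable_sq (measurable_compStep k _) hi), integral_compStep hG hb hZ]
        simp [compSum]
      simp_rw [h1]
      exact ih (k + 1)
  intro n
  -- At level 0 the corrector vanishes, so the bounds apply to the centred log-ratio itself.
  have hTn : ∀ x, m.compSum θ₀ θ Q n 0 x = m.sumLog θ₀ θ n x - n * a := by
    intro x
    rw [compSum, poissonSum_zero, add_zero]
  have hSi : Integrable (m.sumLog θ₀ θ n) (m.law q₀ θ₀ n) := by
    have h1 := (hTi n 0).add (integrable_const (n * a))
    refine h1.congr (ae_of_all _ fun x => ?_)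
    simp only [Pi.add_apply, hTn]
    ring
  refine ⟨hSi, ?_, ?_⟩
  · have h1 := hE n 0
    simp_rw [hTn] at h1
    rw [integral_sub hSi (integrable_const _), integral_const] at h1
    simp only [probReal_univ, one_smul] at h1
    have h2 : 0 ≤ b * (D ^ 2 * Λ + D' * ((v + R) * Λ)) := by positivity
    linarith
  · have h1 := hL n 0
    simp_rw [hTn] at h1
    refine h1.trans (ENNReal.ofReal_le_ofReal ?_)
    have h2 : 0 ≤ b ^ 2 * (D ^ 2 * Λ) * n := by positivity
    have h3 : 0 ≤ b ^ 2 * (D' * ((v + R) * Λ)) := by positivity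
    have h4 : 0 ≤ b ^ 2 * (D * √Λ) * (n + 1) := by positivity
    linarith

end TransitionModel

theorem evariance_le_lintegral_sub_sq {α : Type*} [MeasurableSpace α] {P : Measure α}
    [IsProbabilityMeasure P] {f : α → ℝ} (hf : Integrable f P) (c : ℝ)
    (h : ∫⁻ x, ENNReal.ofReal ((f x - c) ^ 2) ∂P < ∞) :
    evariance f P ≤ ∫⁻ x, ENNReal.ofReal ((f x - c) ^ 2) ∂P := by
  have hm : AEStronglyMeasurable (fun x => f x - c) P := hf.1.sub aestronglyMeasurable_const
  have hs : Integrable (fun x => (f x - c) ^ 2) P := by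
    refine ⟨hm.pow 2, ?_⟩
    rw [hasFiniteIntegral_iff_ofReal (ae_of_all _ fun x => sq_nonneg _)]
    exact h
  have hd : Integrable (fun x => f x - c) P := hf.sub (integrable_const _)
  set a := ∫ x, f x ∂P with ha
  have hexp : ∀ x, (f x - a) ^ 2 = (f x - c) ^ 2 + (2 * (c - a) * (f x - c) + (c - a) ^ 2) :=
    fun x => by ring
  have h2 : Integrable (fun x => 2 * (c - a) * (f x - c) + (c - a) ^ 2) P :=
    (hd.const_mul _).add (integrable_const _)
  have hi : Integrable (fun x => (f x - a) ^ 2) P := by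
    simp_rw [hexp]
    exact hs.add h2
  rw [evariance_eq_lintegral_ofReal, ← ha,
    ← ofReal_integral_eq_lintegral_ofReal hi (ae_of_all _ fun _ => sq_nonneg _),
    ← ofReal_integral_eq_lintegral_ofReal hs (ae_of_all _ fun _ => sq_nonneg _)]
  apply ENNReal.ofReal_le_ofReal
  simp_rw [hexp]
  rw [integral_add hs h2, integral_add (hd.const_mul _) (integrable_const _), integral_const_mul,
    integral_sub hf (integrable_const _), integral_const, integral_const, ← ha]
  simp only [probReal_univ, one_smul]
  nlinarith [sq_nonneg (c - a)]

/-! ### The divergence between path laws as an expected log-ratio -/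

namespace TransitionModel

variable {Θ S : Type*} [MeasurableSpace Θ] [MeasurableSpace S] {μ : Measure S} [SigmaFinite μ]
  {m : TransitionModel Θ S μ} {θ₀ θ : Θ} {q₀ : S → ℝ}

theorem jointDensity_eq_zero (h0 : ∀ y x, m.p θ₀ y x = 0 ↔ m.p θ y x = 0) {n : ℕ}
    {x : Fin (n + 1) → S} (hx : m.jointDensity q₀ θ n x = 0) : m.jointDensity q₀ θ₀ n x = 0 := by
  unfold jointDensity at hx ⊢
  rcases mul_eq_zero.1 hx with h | h
  · rw [h, zero_mul]
  · obtain ⟨i, hi, hi0⟩ := Finset.prod_eq_zero_iff.1 h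
    rw [Finset.prod_eq_zero hi ((h0 _ _).2 hi0), mul_zero]

theorem law_eq_withDensity (hq₀ : IsProbDensity μ q₀)
    (h0 : ∀ y x, m.p θ₀ y x = 0 ↔ m.p θ y x = 0) (n : ℕ) :
    m.law q₀ θ₀ n = (m.law q₀ θ n).withDensity fun x =>
      ENNReal.ofReal (m.jointDensity q₀ θ₀ n x / m.jointDensity q₀ θ n x) := by
  have hj := fun θ => m.measurable_jointDensity hq₀.measurable θ n
  have hd : Measurable fun x =>
      ENNReal.ofReal (m.jointDensity q₀ θ₀ n x / m.jointDensity q₀ θ n x) :=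
    ((hj θ₀).div (hj θ)).ennreal_ofReal
  rw [law, law, ← withDensity_mul _ (hj θ).ennreal_ofReal hd]
  congr 1
  ext x
  have hn := m.jointDensity_nonneg hq₀.nonneg θ n x
  rw [Pi.mul_apply, ← ENNReal.ofReal_mul hn]
  congr 1
  -- Where the denominator is zero the numerator is too, so the convention for division by zero does
  -- no harm.
  by_cases hx : m.jointDensity q₀ θ n x = 0
  · rw [hx, jointDensity_eq_zero h0 hx, zero_mul]
  · field_simp

theorem klDiv_law (hq₀ : IsProbDensity μ q₀) (h0 : ∀ y x, m.p θ₀ y x = 0 ↔ m.p θ y x = 0) (n : ℕ)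
    (hi : Integrable (m.logRatio q₀ θ θ₀ n) (m.law q₀ θ₀ n)) :
    klDiv (m.law q₀ θ₀ n) (m.law q₀ θ n) =
      ENNReal.ofReal (∫ x, m.logRatio q₀ θ θ₀ n x ∂(m.law q₀ θ₀ n)) := by
  have hlaw := fun θ => m.isProbabilityMeasure_law hq₀ θ n
  have hj := fun θ => m.measurable_jointDensity hq₀.measurable θ n
  have hd := law_eq_withDensity hq₀ h0 n
  have hac : m.law q₀ θ₀ n ≪ m.law q₀ θ n := by
    rw [hd]; exact withDensity_absolutelyContinuous _ _
  have hrn : (m.law q₀ θ₀ n).rnDeriv (m.law q₀ θ n) =ᵐ[m.law q₀ θ n] fun x =>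
      ENNReal.ofReal (m.jointDensity q₀ θ₀ n x / m.jointDensity q₀ θ n x) := by
    conv_lhs => rw [hd]
    exact Measure.rnDeriv_withDensity _ ((hj θ₀).div (hj θ)).ennreal_ofReal
  have hllr : llr (m.law q₀ θ₀ n) (m.law q₀ θ n) =ᵐ[m.law q₀ θ₀ n] m.logRatio q₀ θ θ₀ n := by
    filter_upwards [hac.ae_le hrn] with x hx
    rw [llr, hx, ENNReal.toReal_ofReal (div_nonneg (m.jointDensity_nonneg hq₀.nonneg θ₀ n x)
      (m.jointDensity_nonneg hq₀.nonneg θ n x)), logRatio]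
  rw [klDiv_of_ac_of_integrable hac (hi.congr hllr.symm), integral_congr_ae hllr]
  simp

theorem measurable_integral_logRatio (m : TransitionModel Θ S μ) (hq₀ : IsProbDensity μ q₀) (θ₀ : Θ)
    (n : ℕ) : Measurable fun θ => ∫ x, m.logRatio q₀ θ θ₀ n x ∂(m.law q₀ θ₀ n) := by
  have := m.isProbabilityMeasure_law hq₀ θ₀ n
  have h : Measurable (Function.uncurry fun θ x => m.logRatio q₀ θ θ₀ n x) := by
    have h1 : Measurable fun z : Θ × (Fin (n + 1) → S) => m.jointDensity q₀ θ₀ n z.2 :=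
      (m.measurable_jointDensity hq₀.measurable θ₀ n).comp measurable_snd
    exact (h1.div (m.measurable_jointDensity_uncurry hq₀.measurable n)).log
  exact h.stronglyMeasurable.integral_prod_right.measurable

end TransitionModel

/-! ### Moments of the parameter distance under the measures `ρ n` -/

section ParameterMoments

variable {Θ : Type*} [MeasurableSpace Θ] {ρ : Measure Θ} [IsProbabilityMeasure ρ] {f : Θ → ℝ}

theorem integrable_rpow_and_integral_le (hf : Measurable f) (hf0 : ∀ θ, 0 ≤ f θ) {p C : ℝ}
    (hC : 0 ≤ C) {n : ℕ} (hn : 1 ≤ n)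
    (hp : ∫⁻ θ, ENNReal.ofReal (f θ ^ p) ∂ρ ≤ ENNReal.ofReal (C / n)) {e : ℝ} (he : 0 < e)
    (hep : e ≤ p) :
    Integrable (fun θ => f θ ^ e) ρ ∧ ∫ θ, f θ ^ e ∂ρ ≤ (1 + C) * (n : ℝ) ^ (-e / p) := by
  have hn0 : 0 < (n : ℝ) := by exact_mod_cast hn
  have hp0 : 0 < p := he.trans_le hep
  have hfp : Integrable (fun θ => f θ ^ p) ρ := by
    refine ⟨(hf.pow_const p).aestronglyMeasurable, ?_⟩
    rw [hasFiniteIntegral_iff_ofReal (ae_of_all _ fun θ => Real.rpow_nonneg (hf0 θ) _)]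
    exact hp.trans_lt ENNReal.ofReal_lt_top
  have hfpC : ∫ θ, f θ ^ p ∂ρ ≤ C / n := by
    rw [← ENNReal.ofReal_le_ofReal_iff (by positivity),
      ofReal_integral_eq_lintegral_ofReal hfp (ae_of_all _ fun θ => Real.rpow_nonneg (hf0 θ) _)]
    exact hp
  -- This truncation level balances the two terms: both become multiples of `n ^ (-e/p)` when the
  -- moment of order `p` is `C / n`.
  set t : ℝ := (n : ℝ) ^ (-1 / p) with ht
  have ht0 : 0 < t := by positivity
  have hpt : ∀ θ, f θ ^ e ≤ t ^ e + t ^ (e - p) * f θ ^ p := fun θ =>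
    rpow_le_add_mul_rpow (hf0 θ) ht0 he.le hep
  have hdi : Integrable (fun θ => t ^ e + t ^ (e - p) * f θ ^ p) ρ :=
    (integrable_const _).add (hfp.const_mul _)
  have hi : Integrable (fun θ => f θ ^ e) ρ := by
    refine hdi.mono' (hf.pow_const e).aestronglyMeasurable (ae_of_all _ fun θ => ?_)
    rw [Real.norm_eq_abs, abs_of_nonneg (Real.rpow_nonneg (hf0 θ) _)]
    exact hpt θ
  refine ⟨hi, (integral_mono hi hdi hpt).trans ?_⟩
  rw [integral_add (integrable_const _) (hfp.const_mul _), integral_const_mul, integral_const]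
  simp only [probReal_univ, one_smul]
  have e1 : t ^ e = (n : ℝ) ^ (-e / p) := by
    rw [ht, ← Real.rpow_mul hn0.le]
    congr 1
    ring
  have e2 : t ^ (e - p) = (n : ℝ) ^ (-e / p) * n := by
    nth_rewrite 2 [← Real.rpow_one (n : ℝ)]
    rw [ht, ← Real.rpow_mul hn0.le, ← Real.rpow_add hn0]
    congr 1
    field_simp
    ring
  calc t ^ e + t ^ (e - p) * ∫ θ, f θ ^ p ∂ρ ≤ t ^ e + t ^ (e - p) * (C / n) := by gcongr
    _ = _ := by
      rw [e1, e2]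
      field_simp

end ParameterMoments

/-- The place where the exponent 3/2 is needed: at `δ = 1` all three powers of `n` are `n^(-1/2)`.
Below 1 the first term of the maximum dominates, above 1 the second. -/
theorem rpow_exponent_le_max {n : ℕ} (hn : 1 ≤ n) {δ : ℝ} (hδ : 0 < δ) :
    (n : ℝ) * (n : ℝ) ^ (-(3 / 2) / (2 + δ)) ≤
      n * max (1 / √(n : ℝ)) ((n : ℝ) ^ (δ / 2) / n) := by
  have hn1 : 1 ≤ (n : ℝ) := by exact_mod_cast hn
  have hn0 : 0 < (n : ℝ) := by linarith
  gcongr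
  rcases le_total δ 1 with h | h
  · refine le_trans ?_ (le_max_left _ _)
    rw [one_div, Real.sqrt_eq_rpow, ← Real.rpow_neg hn0.le]
    apply Real.rpow_le_rpow_of_exponent_le hn1
    rw [div_le_iff₀ (by linarith)]
    linarith
  · refine le_trans ?_ (le_max_right _ _)
    rw [← Real.rpow_sub_one hn0.ne']
    apply Real.rpow_le_rpow_of_exponent_le hn1
    rw [div_le_iff₀ (by linarith)]
    nlinarith

/-! ### A common envelope for the Lipschitz coefficients -/

section Envelope

variable {S : Type*} [MeasurableSpace S] {K : ℕ} {M1 : Fin K → S → S → ℝ} {p : ℝ}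

/-- A common upper bound `≥ 1` of finitely many functions, of the same integrability. -/
noncomputable def envelope (M1 : Fin K → S → S → ℝ) (p : ℝ) (y x : S) : ℝ :=
  (1 + ∑ k, M1 k y x ^ p) ^ (1 / p)

theorem one_le_one_add_sum (h0 : ∀ k y x, 0 ≤ M1 k y x) (y x : S) :
    1 ≤ 1 + ∑ k, M1 k y x ^ p :=
  le_add_of_nonneg_right (Finset.sum_nonneg fun k _ => Real.rpow_nonneg (h0 k y x) _)

theorem one_le_envelope (h0 : ∀ k y x, 0 ≤ M1 k y x) (hp : 0 < p) (y x : S) :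
    1 ≤ envelope M1 p y x :=
  Real.one_le_rpow (one_le_one_add_sum h0 y x) (by positivity)

theorem envelope_rpow (h0 : ∀ k y x, 0 ≤ M1 k y x) (hp : 0 < p) (y x : S) :
    envelope M1 p y x ^ p = 1 + ∑ k, M1 k y x ^ p := by
  unfold envelope
  rw [← Real.rpow_mul (zero_le_one.trans (one_le_one_add_sum h0 y x)), one_div_mul_cancel hp.ne',
    Real.rpow_one]

theorem le_envelope (h0 : ∀ k y x, 0 ≤ M1 k y x) (hp : 0 < p) (k : Fin K) (y x : S) :
    M1 k y x ≤ envelope M1 p y x := by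
  rw [← Real.rpow_le_rpow_iff (h0 k y x) (zero_le_one.trans (one_le_envelope h0 hp y x)) hp,
    envelope_rpow h0 hp]
  have := Finset.single_le_sum (f := fun k => M1 k y x ^ p)
    (fun k _ => Real.rpow_nonneg (h0 k y x) _) (Finset.mem_univ k)
  linarith

theorem measurable_envelope (h : ∀ k, Measurable fun z : S × S => M1 k z.1 z.2) :
    Measurable fun z : S × S => envelope M1 p z.1 z.2 :=
  ((Finset.measurable_sum _ fun k _ => (h k).pow_const p).const_add 1).pow_const _

theorem lintegral_envelope_rpow (h0 : ∀ k y x, 0 ≤ M1 k y x) (hp : 0 < p)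
    (h : ∀ k, Measurable fun z : S × S => M1 k z.1 z.2) (P : Measure S) [IsProbabilityMeasure P]
    (x : S) :
    ∫⁻ y, ENNReal.ofReal (envelope M1 p y x ^ p) ∂P =
      1 + ∑ k, ∫⁻ y, ENNReal.ofReal (M1 k y x ^ p) ∂P := by
  have hm : ∀ k, Measurable fun y => ENNReal.ofReal (M1 k y x ^ p) := fun k =>
    (((h k).comp (by fun_prop : Measurable fun y : S => (y, x))).pow_const p).ennreal_ofReal
  rw [← lintegral_finsetSum _ fun k _ => hm k]
  have e : ∀ y, ENNReal.ofReal (envelope M1 p y x ^ p) =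
      1 + ∑ k, ENNReal.ofReal (M1 k y x ^ p) := by
    intro y
    rw [envelope_rpow h0 hp, ENNReal.ofReal_add zero_le_one
      (Finset.sum_nonneg fun k _ => Real.rpow_nonneg (h0 k y x) _), ENNReal.ofReal_one,
      ENNReal.ofReal_sum_of_nonneg fun k _ => Real.rpow_nonneg (h0 k y x) _]
  rw [lintegral_congr e, lintegral_add_left measurable_const]
  simp

end Envelope

/-! ### From the Lipschitz assumption to bounds on the log-ratio -/

section Main

variable {Θ S : Type*} [MeasurableSpace Θ] [MeasurableSpace S] {μ : Measure S} [SigmaFinite μ]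
  {m : TransitionModel Θ S μ} {q : Θ → S → ℝ} {θ₀ : Θ} {δ : ℝ} {K : ℕ}
  {M1 : Fin K → S → S → ℝ} {M2 : Fin K → S → ℝ} {f1 f2 : Fin K → Θ → Θ → ℝ}
  {ρ : ℕ → ProbabilityMeasure Θ}

theorem GenLip.exists_comparable (h : GenLip m q θ₀ δ M1 M2 f1 f2 ρ) (hδ : 0 < δ)
    (hq : ∀ θ, IsProbDensity μ (q θ)) (hinv : ∀ θ, (m.kernel θ).Invariant (densityLaw μ (q θ))) :
    ∃ B : ℝ, ∀ θ, m.Comparable θ₀ θ (densityLaw μ (q θ)) (envelope M1 (2 + δ)) (2 + δ) B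
      (∑ k, |f1 k θ θ₀|) := by
  have hp : 0 < 2 + δ := by linarith
  obtain ⟨B, hB⟩ := h.moment_M1
  refine ⟨1 + K * |B|, fun θ => ⟨hinv θ, measurable_envelope h.measurable_M1,
    one_le_envelope h.nonneg_M1 hp, by linarith, by positivity, by positivity, ?_, ?_⟩⟩
  · intro y x
    refine ⟨(h.lip_transition θ₀ θ y x).1, (h.lip_transition θ₀ θ y x).2.trans ?_⟩
    rw [Finset.sum_mul]
    refine Finset.sum_le_sum fun k _ => ?_
    rw [mul_comm]
    gcongr
    exact le_envelope h.nonneg_M1 hp k y x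
  · have := (hq θ).isProbabilityMeasure
    have hkm : ∀ k, Measurable fun z : S × S => ENNReal.ofReal (M1 k z.2 z.1 ^ (2 + δ)) := fun k =>
      (((h.measurable_M1 k).comp measurable_swap).pow_const _).ennreal_ofReal
    have hin : ∀ k, Measurable fun x =>
        ∫⁻ y, ENNReal.ofReal (M1 k y x ^ (2 + δ)) ∂(m.kernel θ x) := fun k =>
      Measurable.lintegral_kernel_prod_right
        (f := fun x y => ENNReal.ofReal (M1 k y x ^ (2 + δ))) (κ := m.kernel θ) (hkm k)
    have hk : ∀ k, ∫⁻ x, ∫⁻ y, ENNReal.ofReal (M1 k y x ^ (2 + δ)) ∂(m.kernel θ x)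
        ∂(densityLaw μ (q θ)) ≤ ENNReal.ofReal |B| := by
      intro k
      refine le_trans (le_of_eq ?_)
        ((hB k θ).le.trans (ENNReal.ofReal_le_ofReal (le_abs_self B)))
      rw [densityLaw, lintegral_withDensity_eq_lintegral_mul _ (hq θ).measurable.ennreal_ofReal
        (hin k)]
      refine lintegral_congr fun x => ?_
      rw [Pi.mul_apply, m.lintegral_kernel θ x (f := fun y => ENNReal.ofReal (M1 k y x ^ (2 + δ)))
        ((hkm k).comp measurable_prodMk_left), ← lintegral_const_mul' _ _ ENNReal.ofReal_ne_top]
      refine lintegral_congr fun y => ?_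
      have h1 := Real.rpow_nonneg (h.nonneg_M1 k y x) (2 + δ)
      rw [ENNReal.ofReal_mul (mul_nonneg h1 (m.nonneg_p θ y x)), ENNReal.ofReal_mul h1]
      ring
    simp_rw [fun x => lintegral_envelope_rpow h.nonneg_M1 hp h.measurable_M1 (m.kernel θ x) x]
    rw [lintegral_add_left measurable_const, lintegral_finsetSum _ fun k _ => hin k]
    calc _ ≤ 1 + ∑ _k : Fin K, ENNReal.ofReal |B| := by
          gcongr with k
          · simp
          · exact hk k
      _ = _ := by
          rw [Finset.sum_const, Finset.card_univ, Fintype.card_fin, nsmul_eq_mul,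
            ENNReal.ofReal_add zero_le_one (by positivity), ENNReal.ofReal_one,
            ENNReal.ofReal_mul (by positivity), ENNReal.ofReal_natCast]

theorem lintegral_envelope_kernel_le {V : S → ℝ} (hV1 : ∀ x, 1 ≤ V x)
    (h : GenLip m q θ₀ δ M1 M2 f1 f2 ρ) (hδ : 0 < δ)
    (hMV : ∀ k x, ∫⁻ y, ENNReal.ofReal (M1 k y x ^ (2 + δ) * m.p θ₀ y x) ∂μ <
      ENNReal.ofReal (V x)) (x : S) :
    ∫⁻ y, ENNReal.ofReal (envelope M1 (2 + δ) y x ^ (2 + δ)) ∂(m.kernel θ₀ x) ≤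
      ENNReal.ofReal ((1 + K) * V x) := by
  have hp : 0 < 2 + δ := by linarith
  have hV0 : 0 ≤ V x := zero_le_one.trans (hV1 x)
  rw [lintegral_envelope_rpow h.nonneg_M1 hp h.measurable_M1]
  have hk : ∀ k, ∫⁻ y, ENNReal.ofReal (M1 k y x ^ (2 + δ)) ∂(m.kernel θ₀ x) ≤
      ENNReal.ofReal (V x) := by
    intro k
    refine le_trans (le_of_eq ?_) (hMV k x).le
    rw [m.lintegral_kernel θ₀ x (f := fun y => ENNReal.ofReal (M1 k y x ^ (2 + δ)))
      ((((h.measurable_M1 k).comp (by fun_prop : Measurable fun y : S => (y, x))).pow_const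
        _).ennreal_ofReal)]
    refine lintegral_congr fun y => ?_
    rw [ENNReal.ofReal_mul (Real.rpow_nonneg (h.nonneg_M1 k y x) _), mul_comm]
  calc _ ≤ ENNReal.ofReal (V x) + ∑ _k : Fin K, ENNReal.ofReal (V x) := by
        gcongr with k
        · rw [← ENNReal.ofReal_one]; exact ENNReal.ofReal_le_ofReal (hV1 x)
        · exact hk k
    _ = _ := by
        rw [Finset.sum_const, Finset.card_univ, Fintype.card_fin, nsmul_eq_mul, add_mul, one_mul,
          ENNReal.ofReal_add hV0 (by positivity), ENNReal.ofReal_mul (by positivity),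
          ENNReal.ofReal_natCast]

theorem GenLip.exists_moment (h : GenLip m q θ₀ δ M1 M2 f1 f2 ρ) (hδ : 0 < δ) :
    ∃ C : ℝ, 0 ≤ C ∧ ∀ n : ℕ, 1 ≤ n →
      ∫⁻ θ, ENNReal.ofReal ((∑ k, |f1 k θ θ₀|) ^ (2 + δ)) ∂(ρ n : Measure Θ) ≤
        ENNReal.ofReal (C / n) := by
  obtain ⟨C, hC⟩ := h.moment_f1
  refine ⟨(K : ℝ) ^ (2 + δ - 1) * ∑ k, |C k|, by positivity, fun n hn => ?_⟩
  have hn0 : 0 < (n : ℝ) := by exact_mod_cast hn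
  have hm : ∀ k, Measurable fun θ => ENNReal.ofReal (|f1 k θ θ₀| ^ (2 + δ)) := fun k => by
    have := (h.measurable_f1 k).norm.pow_const (2 + δ)
    exact this.ennreal_ofReal
  have hpt : ∀ θ, ENNReal.ofReal ((∑ k, |f1 k θ θ₀|) ^ (2 + δ)) ≤
      ENNReal.ofReal ((K : ℝ) ^ (2 + δ - 1)) * ∑ k, ENNReal.ofReal (|f1 k θ θ₀| ^ (2 + δ)) := by
    intro θ
    have h1 := Real.rpow_sum_le_const_mul_sum_rpow Finset.univ (fun k => f1 k θ θ₀)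
      (by linarith : 1 ≤ 2 + δ)
    rw [Finset.card_univ, Fintype.card_fin] at h1
    rw [← ENNReal.ofReal_sum_of_nonneg fun k _ => by positivity,
      ← ENNReal.ofReal_mul (by positivity)]
    exact ENNReal.ofReal_le_ofReal h1
  refine (lintegral_mono hpt).trans ?_
  rw [lintegral_const_mul' _ _ ENNReal.ofReal_ne_top, lintegral_finsetSum _ fun k _ => hm k,
    mul_div_assoc, ENNReal.ofReal_mul (by positivity), Finset.sum_div,
    ENNReal.ofReal_sum_of_nonneg fun k _ => by positivity]
  gcongr with k
  exact (hC k n hn).le.trans (ENNReal.ofReal_le_ofReal (by gcongr; exact le_abs_self _))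

/-- Bounds on the expectation and the variance of the log-likelihood ratio of the first `n` steps
that are locally of higher order in the parameter. -/
theorem GenLip.exists_logRatio_bounds (h : GenLip m q θ₀ δ M1 M2 f1 f2 ρ) (hδ : 0 < δ)
    (hq : ∀ θ, IsProbDensity μ (q θ)) (hinv : ∀ θ, (m.kernel θ).Invariant (densityLaw μ (q θ)))
    {q₀ : S → ℝ} (hq₀ : IsProbDensity μ q₀) {V : S → ℝ} {r R : ℝ}
    (hG : GeomErg (m.kernel θ₀) (densityLaw μ (q θ₀)) V r R)
    (hMV : ∀ k x, ∫⁻ y, ENNReal.ofReal (M1 k y x ^ (2 + δ) * m.p θ₀ y x) ∂μ <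
      ENNReal.ofReal (V x)) (hV₀ : Integrable V (densityLaw μ q₀)) :
    ∃ C : ℝ, 0 ≤ C ∧ ∀ (n : ℕ) (θ : Θ),
      Integrable (m.logRatio q₀ θ θ₀ n) (m.law q₀ θ₀ n) ∧
      |∫ x, m.logRatio q₀ θ θ₀ n x ∂(m.law q₀ θ₀ n)| ≤ C * (n + 1) * ∑ k, |f1 k θ θ₀| ∧
      ∫ x, m.logRatio q₀ θ θ₀ n x ∂(m.law q₀ θ₀ n) ≤
        C * (n * (∑ k, |f1 k θ θ₀|) ^ (3 / 2 : ℝ) + ∑ k, |f1 k θ θ₀|) ∧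
      evariance (m.logRatio q₀ θ θ₀ n) (m.law q₀ θ₀ n) ≤
        ENNReal.ofReal (C * (n + 1) * (∑ k, |f1 k θ θ₀|) ^ 2) := by
  have := (hq θ₀).isProbabilityMeasure
  have hV0 : ∀ x, 0 ≤ V x := fun x => (hG.V_pos x).le
  obtain ⟨B, hcomp⟩ := h.exists_comparable hδ hq hinv
  have hMV' := lintegral_envelope_kernel_le hG.one_le_V h hδ hMV
  obtain ⟨C₁, hC₁, hmean⟩ := TransitionModel.Comparable.exists_integral_stepLog_le (B := B)
    (by linarith : 2 < 2 + δ) (hq θ₀) hG (by positivity) hMV'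
  obtain ⟨C₂, hC₂, hpath⟩ := TransitionModel.exists_sumLog_bounds hq₀ hG hV₀
  set L : ℝ := 1 + K with hL
  have hL0 : 0 ≤ L := by positivity
  set v := ∫ x, V x ∂(densityLaw μ (q θ₀)) with hv
  have hv1 : 1 ≤ v := hG.one_le_integral
  refine ⟨C₁ + C₂ * √L + √L * √v + C₂ * L, by positivity, fun n θ => ?_⟩
  have hc := hcomp θ
  have hs := hc.nonneg_s
  have hm := hmean θ (q θ) _ (hq θ) hc
  set s := ∑ k, |f1 k θ θ₀| with hsdef
  -- The path bounds apply with `b = √L * s`, where `L = 1 + K` comes from the conditional moment of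
  -- the envelope.
  have hZ : ∀ x, ∫⁻ y, ENNReal.ofReal (m.stepLog θ₀ θ y x ^ 2) ∂(m.kernel θ₀ x) ≤
      ENNReal.ofReal ((√L * s) ^ 2 * V x) := by
    intro x
    calc ∫⁻ y, ENNReal.ofReal (m.stepLog θ₀ θ y x ^ 2) ∂(m.kernel θ₀ x)
        ≤ ∫⁻ y, ENNReal.ofReal (s ^ 2) *
            ENNReal.ofReal (envelope M1 (2 + δ) y x ^ (2 + δ)) ∂(m.kernel θ₀ x) := by
          refine lintegral_mono fun y => ?_
          rw [← ENNReal.ofReal_mul (sq_nonneg s)]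
          apply ENNReal.ofReal_le_ofReal
          rw [← sq_abs]
          calc _ ≤ (s * envelope M1 (2 + δ) y x) ^ 2 := by
                gcongr
                exact hc.abs_stepLog_le y x
            _ = s ^ 2 * envelope M1 (2 + δ) y x ^ 2 := mul_pow _ _ _
            _ ≤ _ := by
                gcongr
                exact hc.M_sq_le y x
      _ = ENNReal.ofReal (s ^ 2) *
            ∫⁻ y, ENNReal.ofReal (envelope M1 (2 + δ) y x ^ (2 + δ)) ∂(m.kernel θ₀ x) :=
          lintegral_const_mul' _ _ ENNReal.ofReal_ne_top
      _ ≤ ENNReal.ofReal (s ^ 2) * ENNReal.ofReal (L * V x) := by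
          gcongr
          exact hMV' x
      _ = _ := by
          rw [← ENNReal.ofReal_mul (sq_nonneg s), mul_pow, Real.sq_sqrt hL0]
          congr 1
          ring
  have hb : 0 ≤ √L * s := by positivity
  obtain ⟨hi, hE, hvar⟩ := hpath θ _ hb hZ n
  have hae := m.logRatio_ae_eq_sumLog hq₀ (fun y x => (hc.logClose y x).1) n
  have hmabs : |∫ x, m.meanStep θ₀ θ x ∂(densityLaw μ (q θ₀))| ≤ √L * s * √v :=
    hG.abs_integral_le hG.integrable_V (by linarith) le_rfl hb
      (TransitionModel.abs_meanStep_le hV0 hb hZ)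
  change ∫ x, m.meanStep θ₀ θ x ∂(densityLaw μ (q θ₀)) ≤ _ at hm
  have hlawP := m.isProbabilityMeasure_law hq₀ θ₀ n
  rw [integral_congr_ae hae, evariance_congr hae]
  set a := ∫ x, m.meanStep θ₀ θ x ∂(densityLaw μ (q θ₀)) with ha
  have hn0 : (0 : ℝ) ≤ n := Nat.cast_nonneg n
  have hE' := abs_le.1 hE
  have hw : 0 ≤ s ^ (3 / 2 : ℝ) := by positivity
  refine ⟨hi.congr hae.symm, ?_, ?_, ?_⟩
  · have h1 : |∫ x, m.sumLog θ₀ θ n x ∂(m.law q₀ θ₀ n)| ≤ C₂ * (√L * s) + n * (√L * s * √v) := by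
      calc |∫ x, m.sumLog θ₀ θ n x ∂(m.law q₀ θ₀ n)|
          = |(∫ x, m.sumLog θ₀ θ n x ∂(m.law q₀ θ₀ n) - n * a) + n * a| := by ring_nf
        _ ≤ _ := abs_add_le _ _
        _ ≤ _ := by
          rw [abs_mul, Nat.abs_cast]
          gcongr
    have h2 : 0 ≤ C₁ * (n + 1) * s := by positivity
    have h3 : 0 ≤ C₂ * √L * n * s := by positivity
    have h4 : 0 ≤ √L * √v * s := by positivity
    have h5 : 0 ≤ C₂ * L * (n + 1) * s := by positivity
    linarith
  · have h1 : n * a ≤ n * (C₁ * s ^ (3 / 2 : ℝ)) := by gcongr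
    have h2 : 0 ≤ (C₂ * √L + √L * √v + C₂ * L) * (n * s ^ (3 / 2 : ℝ)) := by positivity
    have h3 : 0 ≤ (C₁ + √L * √v + C₂ * L) * s := by positivity
    linarith [hE'.2]
  · refine (evariance_le_lintegral_sub_sq hi (n * a) (hvar.trans_lt ENNReal.ofReal_lt_top)).trans
      (hvar.trans (ENNReal.ofReal_le_ofReal ?_))
    rw [mul_pow, Real.sq_sqrt hL0]
    have h1 : 0 ≤ (C₁ + C₂ * √L + √L * √v) * (n + 1) * s ^ 2 := by positivity
    linarith

end Main

end MarkovPACBayes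

/-! ### The theorem: integration over the parameter -/

open MarkovPACBayes
theorem mainTheorem6 {Θ S : Type*} [MeasurableSpace Θ] [MeasurableSpace S]
    (μ : Measure S) [SigmaFinite μ]
    (m : TransitionModel Θ S μ) (θ₀ : Θ)
    (q : Θ → S → ℝ) (hq : ∀ θ, IsProbDensity μ (q θ))
    (hinv : ∀ θ, (m.kernel θ).Invariant (densityLaw μ (q θ)))
    (q₀ : S → ℝ) (hq₀ : IsProbDensity μ q₀)
    (π : Measure Θ) [IsProbabilityMeasure π]
    (F : Set (ProbabilityMeasure Θ)) (ρ : ℕ → ProbabilityMeasure Θ)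
    (hρ : ∀ n, 1 ≤ n → ρ n ∈ F)
    (hap : IsAperiodic (m.kernel θ₀) (densityLaw μ (q θ₀)))
    (V : S → ℝ) (hVm : Measurable V) (hV1 : ∀ x, 1 ≤ V x)
    (hV : IsVGeometricallyErgodic (m.kernel θ₀) (densityLaw μ (q θ₀)) V)
    (δ : ℝ) (hδ : 0 < δ) {K : ℕ}
    (M1 : Fin K → S → S → ℝ) (M2 : Fin K → S → ℝ) (f1 f2 : Fin K → Θ → Θ → ℝ)
    (hlip : GenLip m q θ₀ δ M1 M2 f1 f2 ρ)
    (hMV : ∀ k x, ∫⁻ y, ENNReal.ofReal (M1 k y x ^ (2 + δ) * m.p θ₀ y x) ∂μ <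
      ENNReal.ofReal (V x))
    (C : ℝ) (hC : 0 < C)
    (hprior : ∀ n : ℕ, 1 ≤ n →
      klDiv (ρ n : Measure Θ) π ≤ ENNReal.ofReal (C * Real.sqrt n))
    (hinit : ∫⁻ x, ENNReal.ofReal (V x) ∂(densityLaw μ q₀) < ∞) :
    ∃ ε : ℕ → ℝ,
      ε =O[atTop] (fun n : ℕ => max (1 / Real.sqrt n) ((n : ℝ) ^ (δ / 2) / n)) ∧
      ∀ n : ℕ, 1 ≤ n → PACBayesConditions m q₀ θ₀ π F n (ε n) (ρ n) := by
  have := (hq θ₀).isProbabilityMeasure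
  obtain ⟨r, R, hG⟩ := hV.exists_geomErg hVm hV1
  have hV₀ : Integrable V (densityLaw μ q₀) := by
    refine ⟨hVm.aestronglyMeasurable, ?_⟩
    rw [hasFiniteIntegral_iff_ofReal (ae_of_all _ fun x => zero_le_one.trans (hV1 x))]
    exact hinit
  obtain ⟨A, hA, hbounds⟩ := hlip.exists_logRatio_bounds hδ hq hinv hq₀ hG hMV hV₀
  obtain ⟨C', hC', hmom⟩ := hlip.exists_moment hδ
  set s : Θ → ℝ := fun θ => ∑ k, |f1 k θ θ₀| with hsdef
  have hsm : Measurable s := Finset.measurable_sum _ fun k _ => (hlip.measurable_f1 k).norm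
  have hs0 : ∀ θ, 0 ≤ s θ := fun θ => Finset.sum_nonneg fun k _ => abs_nonneg _
  set w : ℕ → ℝ := fun n => max (1 / √(n : ℝ)) ((n : ℝ) ^ (δ / 2) / n) with hw
  -- The 2 covers the two terms `n s^(3/2)` and `s` of the expectation, and also `n + 1 ≤ 2 n` in
  -- the variance. The summand `C` pays for the prior.
  set D : ℝ := 2 * A * (1 + C') + C with hD
  refine ⟨fun n => D * w n, (isBigO_refl w atTop).const_mul_left D, fun n hn => ?_⟩
  have hn1 : (1 : ℝ) ≤ n := by exact_mod_cast hn
  have hn0 : (0 : ℝ) < n := by linarith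
  have hsqrt : √(n : ℝ) ≤ n * w n := by
    calc √(n : ℝ) = n * (1 / √(n : ℝ)) := by
          rw [mul_one_div, Real.div_sqrt]
      _ ≤ n * w n := by gcongr; exact le_max_left _ _
  have hnw1 : 1 ≤ n * w n := le_trans (by rw [Real.one_le_sqrt]; exact hn1) hsqrt
  have hnw0 : 0 < n * w n := by linarith
  have hw0 : 0 < w n := pos_of_mul_pos_right hnw0 hn0.le
  have hp0 : 0 < 2 + δ := by linarith
  have hmoment := fun {e : ℝ} (he : 0 < e) (hep : e ≤ 2 + δ) =>
    integrable_rpow_and_integral_le (ρ := (ρ n : Measure Θ)) hsm hs0 hC' hn (hmom n hn) he hep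
  obtain ⟨hi1, hm1⟩ := hmoment zero_lt_one (by linarith)
  obtain ⟨hi32, hm32⟩ := hmoment (e := 3 / 2) (by norm_num) (by linarith)
  obtain ⟨hi2, hm2⟩ := hmoment (e := 2) (by norm_num) (by linarith)
  simp only [Real.rpow_one, Real.rpow_two] at hi1 hm1 hi2 hm2
  have hkey := rpow_exponent_le_max hn hδ
  -- The first-order term comes from the initial state only and carries no factor `n`, so
  -- boundedness is enough.
  have hb1 : ∫ θ, s θ ∂(ρ n : Measure Θ) ≤ (1 + C') * (n * w n) := by
    refine hm1.trans ?_
    gcongr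
    refine le_trans ?_ hnw1
    exact Real.rpow_le_one_of_one_le_of_nonpos hn1 (by
      rw [neg_div]; exact neg_nonpos.2 (by positivity))
  have hb32 : n * ∫ θ, s θ ^ (3 / 2 : ℝ) ∂(ρ n : Measure Θ) ≤ (1 + C') * (n * w n) := by
    calc _ ≤ n * ((1 + C') * (n : ℝ) ^ (-(3 / 2) / (2 + δ))) := by gcongr
      _ = (1 + C') * (n * (n : ℝ) ^ (-(3 / 2) / (2 + δ))) := by ring
      _ ≤ _ := by gcongr
  have hb2 : n * ∫ θ, s θ ^ 2 ∂(ρ n : Measure Θ) ≤ (1 + C') * (n * w n) := by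
    calc _ ≤ n * ((1 + C') * (n : ℝ) ^ (-2 / (2 + δ))) := by gcongr
      _ = (1 + C') * (n * (n : ℝ) ^ (-2 / (2 + δ))) := by ring
      _ ≤ (1 + C') * (n * (n : ℝ) ^ (-(3 / 2) / (2 + δ))) := by
        gcongr
        norm_num
      _ ≤ _ := by gcongr
  have hint := fun θ => (hbounds n θ).1
  have hEi : Integrable (fun θ => ∫ x, m.logRatio q₀ θ θ₀ n x ∂(m.law q₀ θ₀ n))
      (ρ n : Measure Θ) :=
    (hi1.const_mul (A * (n + 1))).mono'
      (m.measurable_integral_logRatio hq₀ θ₀ n).aestronglyMeasurable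
      (ae_of_all _ fun θ => (hbounds n θ).2.1)
  have hGi : Integrable (fun θ => A * (n * s θ ^ (3 / 2 : ℝ) + s θ)) (ρ n : Measure Θ) :=
    ((hi32.const_mul _).add hi1).const_mul A
  have hGle : ∫ θ, A * (n * s θ ^ (3 / 2 : ℝ) + s θ) ∂(ρ n : Measure Θ) ≤ n * (D * w n) := by
    rw [integral_const_mul, integral_add (hi32.const_mul _) hi1, integral_const_mul]
    have h1 := mul_le_mul_of_nonneg_left (add_le_add hb32 hb1) hA
    have h2 : 0 ≤ C * (n * w n) := by positivity
    linarith
  have hDw : n * (D * w n) = D * (n * w n) := by ring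
  have hkl := fun θ => TransitionModel.klDiv_law hq₀
    (fun y x => (hlip.lip_transition θ₀ θ y x).1) n (hint θ)
  refine
    { pos := by positivity
      mem := hρ n hn
      integrable_logRatio := hint
      kl_eq := hkl
      integrable_expectation := hEi
      expectation_le := (integral_mono hEi hGi fun θ => (hbounds n θ).2.2.1).trans hGle
      kl_le := ?_
      variance_le := ?_
      prior_le := ?_ }
  · simp_rw [hkl]
    refine (lintegral_mono fun θ => ENNReal.ofReal_le_ofReal (hbounds n θ).2.2.1).trans ?_
    rw [← ofReal_integral_eq_lintegral_ofReal hGi (ae_of_all _ fun θ => by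
      have := hs0 θ
      positivity)]
    exact ENNReal.ofReal_le_ofReal hGle
  · refine (lintegral_mono fun θ => (hbounds n θ).2.2.2).trans ?_
    rw [← ofReal_integral_eq_lintegral_ofReal (hi2.const_mul _) (ae_of_all _ fun θ => by positivity)]
    apply ENNReal.ofReal_le_ofReal
    rw [integral_const_mul]
    have h0 : 0 ≤ ∫ θ, s θ ^ 2 ∂(ρ n : Measure Θ) := integral_nonneg fun θ => sq_nonneg _
    have h1 : A * (n + 1) * ∫ θ, s θ ^ 2 ∂(ρ n : Measure Θ) ≤
        A * (n + n) * ∫ θ, s θ ^ 2 ∂(ρ n : Measure Θ) := by gcongr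
    have h2 := mul_le_mul_of_nonneg_left hb2 hA
    have h3 : 0 ≤ C * (n * w n) := by positivity
    linarith
  · refine (hprior n hn).trans (ENNReal.ofReal_le_ofReal ?_)
    have h1 : C * √(n : ℝ) ≤ C * (n * w n) := by gcongr
    have h2 : 0 ≤ 2 * A * (1 + C') * (n * w n) := by positivity
    linarith
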